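/- Let $\sigma>0$ be known and fixed, $a>0$, and let $L:(0,\infty)\to(0,\infty)$ be measurable, non-constant and slowly varying ($L(\alpha x)/L(x)\to1$ as $x\to\infty$ for each $\alpha>0$), with $\int_0^\infty t^{-a-1}L(t)\,dt<\infty$, $\sup_{t>0}L(t)<\infty$, and $L(t)\ge c_0$ for all $t\ge t_0$, for some $c_0,t_0>0$. For every $n$ let $\mathbf X=(\mathbf X_1,\dots,\mathbf X_{G_n})$ be an $n\times p$ design matrix, where $\mathbf X_g$ is the block of the $m_g$ columns of the $g$-th group, $p=\sum_g m_g$ and $G_n\le n$, and let the data satisfy $\mathbf y\sim\mathcal N_n(\mathbf X\boldsymbol\beta^0,\sigma^2I_n)$ with true coefficients $\boldsymbol\beta^0=(\boldsymbol\beta^0_g)_{g\le G_n}$, $\boldsymbol\beta_g^0\in\mathbb R^{m_g}$. A group $g$ is active if $\boldsymbol\beta_g^0\ne\mathbf 0$; $\mathcal A$ is the set of active groups. ($\mathbf X$, $G_n$, $m_g$, $\boldsymbol\beta^0$ and $\mathcal A$ may vary with $n$.) Consider the hierarchical Bayesian model $$\mathbf y\mid\boldsymbol\beta\sim\mathcal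 N_n(\mathbf X\boldsymbol\beta,\sigma^2I_n),\qquad \boldsymbol\beta_g\mid\lambda_g^2\sim\mathcal N_{m_g}\big(\mathbf 0,\lambda_g^2\sigma^2\tau^2(\mathbf X_g^{\mathrm T}\mathbf X_g)^{-1}\big),\qquad \pi(\lambda_g^2)\propto(\lambda_g^2)^{-a-1}L(\lambda_g^2),$$ the $(\lambda_g^2,\boldsymbol\beta_g)$ being independent over $g$, and put $\kappa_g=1/(1+\lambda_g^2\tau^2)$. Let $\widehat{\boldsymbol\beta}=(\mathbf X^{\mathrm T}\mathbf X)^{-1}\mathbf X^{\mathrm T}\mathbf y$ be the least squares estimate and, for constants $c_1\ge2$, $c_2\ge1$, $$\widehat\tau^{EB}=\max\Big\{\frac1{G_n},\ \frac1{c_2G_n}\#\Big\{g\le G_n:\frac{\widehat{\boldsymbol\beta}_g^{\mathrm T}\mathbf X_g^{\mathrm T}\mathbf X_g\widehat{\boldsymbol\beta}_g}{\sigma^2}>c_1\log G_n\Big\}\Big\}.$$ The empirical Bayes half-thresholding estimator is $$\widehat{\boldsymbol\beta}^{HT}_{g,EB}=E(\boldsymbol\beta_g\mid\tau,\sigma^2,\mathbf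 y)\ \mathbf 1\{E(1-\kappa_g\mid\tau,\sigma^2,\mathbf y)>\tfrac12\}\Big|_{\tau=\widehat\tau^{EB}},$$ where the expectations are posterior expectations in the above model. Assume that, for all sufficiently large $n$, the design is orthogonal, $\mathbf X^{\mathrm T}\mathbf X=nI_p$; the number $|\mathcal A|$ of active groups does not depend on $n$; the group sizes are bounded, $m_g\le s$ for all $g\le G_n$; and $|\beta^0_{gj}|>C_3$ for all $g\in\mathcal A$ and all $j$, where $s$ and $C_3>0$ do not depend on $n$. Then for every active group $g$ (more generally, for every sequence $g=g_n$ of groups, of a common size $m_g$, that are active for all large $n$), $$\sqrt n\,\big(\widehat{\boldsymbol\beta}^{HT}_{g,EB}-\boldsymbol\beta_g^0\big)\ \xrightarrow{d}\ \mathcal N_{m_g}(\mathbf 0,\sigma^2I_{m_g})\qquad\text{as }n\to\infty.$$ -/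

import Mathlib

open MeasureTheory ProbabilityTheory Filter Topology

noncomputable section

namespace GroupHT

/-- The density at `x` of the multivariate normal law `N(μ, S)` (for positive definite `S`). -/
def mvnDensity {ι : Type*} [Fintype ι] [DecidableEq ι]
    (μ : ι → ℝ) (S : Matrix ι ι ℝ) (x : ι → ℝ) : ℝ :=
  (Real.sqrt ((2 * Real.pi) ^ Fintype.card ι * S.det))⁻¹ *
    Real.exp (-(1 / 2) * ((x - μ) ⬝ᵥ (S⁻¹.mulVec (x - μ))))

/-- The spherical normal law `N(μ, σ² I)` as a measure: the product of the laws
`N(μ i, σ²)`. -/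
abbrev sphericalNormal {ι : Type*} [Fintype ι] (μ : ι → ℝ) (σ : ℝ) : Measure (ι → ℝ) :=
  Measure.pi (fun i => gaussianReal (μ i) (σ ^ 2).toNNReal)

/-- A grouped regression design with `n` observations: `G` groups, the `g`-th of them holding
`m g` covariates, and the `n × p` design matrix, `p = ∑ g, m g`, whose columns are indexed by
the pairs (group, member of the group). -/
structure Design (n : ℕ) where
  /-- number of groups -/
  G : ℕ
  /-- group sizes -/
  m : Fin G → ℕ
  /-- design matrix -/
  X : Matrix (Fin n) ((g : Fin G) × Fin (m g)) ℝ

namespace Design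

variable {n : ℕ} (D : Design n)

/-- Coefficient vectors `β = (β_1, …, β_G)`, `β_g ∈ ℝ^{m_g}`. -/
abbrev Coef : Type := (g : Fin D.G) → Fin (D.m g) → ℝ

/-- Parameter values `(λ²_g, β_g)_{g = 1, …, G}`: the first component of `θ g` is the local
shrinkage parameter `λ²_g`, the second one is `β_g`. -/
abbrev Param : Type := (g : Fin D.G) → ℝ × (Fin (D.m g) → ℝ)

/-- The design is orthogonal: `Xᵀ X = n I_p`. -/
def IsOrthogonal : Prop := D.X.transpose * D.X = (n : ℝ) • 1

/-- The block `X_g` of the design matrix. -/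
def block (g : Fin D.G) : Matrix (Fin n) (Fin (D.m g)) ℝ :=
  D.X.submatrix id (fun j => ⟨g, j⟩)

/-- The vector `X β`. -/
def fit (β : D.Coef) : Fin n → ℝ := D.X.mulVec (fun k => β k.1 k.2)

/-- The least squares estimate `(Xᵀ X)⁻¹ Xᵀ y`, group by group. -/
def leastSquares (y : Fin n → ℝ) : D.Coef := fun g j =>
  ((D.X.transpose * D.X)⁻¹.mulVec (D.X.transpose.mulVec y)) ⟨g, j⟩

/-- `Q_g = X_gᵀ X_g / n`. -/
def Q (g : Fin D.G) : Matrix (Fin (D.m g)) (Fin (D.m g)) ℝ :=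
  (n : ℝ)⁻¹ • ((D.block g).transpose * D.block g)

/-- The statistic `n β̂_gᵀ Q_g β̂_g / σ²`. -/
def W (σ : ℝ) (y : Fin n → ℝ) (g : Fin D.G) : ℝ :=
  (n : ℝ) * (D.leastSquares y g ⬝ᵥ (D.Q g).mulVec (D.leastSquares y g)) / σ ^ 2

open Classical in
/-- The set of active groups of a coefficient vector: those with `β_g ≠ 0`. -/
def active (β : D.Coef) : Finset (Fin D.G) := Finset.univ.filter (fun g => β g ≠ 0)

open Classical in
/-- The empirical Bayes estimate of the global shrinkage parameter,
`max {1 / G, (c₂ G)⁻¹ #{g : n β̂_gᵀ Q_g β̂_g / σ² > c₁ log G}}`. -/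
def tauEB (c₁ c₂ σ : ℝ) (y : Fin n → ℝ) : ℝ :=
  max (1 / (D.G : ℝ))
    (1 / (c₂ * D.G) *
      ((Finset.univ.filter (fun g => c₁ * Real.log D.G < D.W σ y g)).card : ℝ))

end Design

/-- The prior density of a local shrinkage parameter `λ²`: proportional to `t ^ (-a - 1) L t` on
`(0, ∞)`, zero elsewhere, with total mass one. -/
def localPrior (a : ℝ) (L : ℝ → ℝ) : ℝ → ℝ :=
  (Set.Ioi (0 : ℝ)).indicator
    (fun t => t ^ (-a - 1) * L t / ∫ s in Set.Ioi (0 : ℝ), s ^ (-a - 1) * L s)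

/-- `L : (0, ∞) → (0, ∞)` is measurable, non-constant and slowly varying in Karamata's sense, and
`t ^ (-a - 1) L t` is the unnormalized density of a probability law on `(0, ∞)`. Values of `L`
outside of `(0, ∞)` play no role. -/
structure IsPriorFactor (a : ℝ) (L : ℝ → ℝ) : Prop where
  pos : ∀ t, 0 < t → 0 < L t
  measurable : Measurable (fun t : Set.Ioi (0 : ℝ) => L t)
  nonconstant : ∃ s t, 0 < s ∧ 0 < t ∧ L s ≠ L t
  slowlyVarying : ∀ α, 0 < α → Tendsto (fun x => L (α * x) / L x) atTop (𝓝 1)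
  integrable : IntegrableOn (fun t => t ^ (-a - 1) * L t) (Set.Ioi 0)

/-- `L` is bounded above on `(0, ∞)`, and bounded away from zero near infinity. -/
structure IsBoundedFactor (L : ℝ → ℝ) : Prop where
  lower : ∃ c₀ t₀, 0 < c₀ ∧ 0 < t₀ ∧ ∀ t, t₀ ≤ t → c₀ ≤ L t
  upper : ∃ M, 0 < M ∧ ∀ t, 0 < t → L t ≤ M

namespace Design

variable {n : ℕ} (D : Design n) (a : ℝ) (L : ℝ → ℝ) (σ : ℝ)

/-- The joint density of the data `y` and of the parameters `(λ²_g, β_g)_g` in the hierarchy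
`y | β ~ N_n (X β, σ² I_n)`, `β_g | λ²_g ~ N (0, λ²_g σ² τ² (X_gᵀ X_g)⁻¹)` independently,
`λ²_g ~ localPrior a L` independently, for fixed `σ` and `τ`. -/
def jointDensity (τ : ℝ) (y : Fin n → ℝ) (θ : D.Param) : ℝ :=
  mvnDensity (D.fit (fun g => (θ g).2)) ((σ ^ 2) • (1 : Matrix (Fin n) (Fin n) ℝ)) y *
    ∏ g, (localPrior a L (θ g).1 *
      mvnDensity 0
        (((θ g).1 * σ ^ 2 * τ ^ 2) • ((D.block g).transpose * D.block g)⁻¹) (θ g).2)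

/-- The posterior expectation `E (f (θ) | τ, σ², y)`, by Bayes' formula. -/
def posteriorExp (τ : ℝ) (y : Fin n → ℝ) (f : D.Param → ℝ) : ℝ :=
  (∫ θ : D.Param, f θ * D.jointDensity a L σ τ y θ) /
    ∫ θ : D.Param, D.jointDensity a L σ τ y θ

/-- The posterior shrinkage weight `E (1 - κ_g | τ, σ², y)`, `κ_g = 1 / (1 + λ²_g τ²)`. -/
def shrinkWeight (τ : ℝ) (y : Fin n → ℝ) (g : Fin D.G) : ℝ :=
  D.posteriorExp a L σ τ y (fun θ => 1 - 1 / (1 + (θ g).1 * τ ^ 2))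

/-- The posterior mean `E (β_g | τ, σ², y)`. -/
def posteriorMean (τ : ℝ) (y : Fin n → ℝ) : D.Coef := fun g j =>
  D.posteriorExp a L σ τ y (fun θ => (θ g).2 j)

/-- The half-thresholding estimator at the global parameter `τ`: the posterior mean of `β_g` if
`E (1 - κ_g | τ, σ², y) > 1 / 2`, and zero otherwise. -/
def halfThreshold (τ : ℝ) (y : Fin n → ℝ) : D.Coef := fun g =>
  if 1 / 2 < D.shrinkWeight a L σ τ y g then D.posteriorMean a L σ τ y g else 0

/-- The empirical Bayes half-thresholding estimator: the half-thresholding estimator at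
`τ = tauEB`. -/
def halfThresholdEB (c₁ c₂ : ℝ) (y : Fin n → ℝ) : D.Coef :=
  D.halfThreshold a L σ (D.tauEB c₁ c₂ σ y) y

end Design

end GroupHT

end

noncomputable section

namespace GroupHT

/-! For an orthogonal design the joint density factorises over the groups. Given `λ_g²`, the
coefficients of group `g` are normal with mean `(1 - κ_g)` times least squares, so the posterior
mean is the least squares estimate times the scalar `1 - E κ_g`, the very number that is compared
with `1/2`. It depends on the data only through `τ` and the statistic `W` of the group
(`posteriorMean_eq`, `shrinkWeight_eq`).

The rescaled least squares error is exactly `N(0, σ² I)` (`map_leastSquares`), so by Slutsky it is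
enough that `√n · E κ · |β̂_gj| ≤ σ √W · E κ` tends to zero in probability. On an active group `W ≥
c n` with probability tending to one, hence `c / W ≤ 1 / n ≤ 1 / G ≤ τ ≤ 1`. The bound on `√W · E κ`
is uniform over this range of `τ` (`exists_sqrt_mul_meanKappa_le`), so the dependence of the
plugged-in `τ` on the data is harmless.

For that bound, `E κ` is split at a level `η`: values of `κ` above `η` carry a likelihood factor of
at most `exp (-W η / 2)`, while the heavy tail of the prior keeps the normalising integral above a
negative power of `W`. The choice `η = W ^ (-3/4)` suits both terms. -/

theorem charFun_centered_gaussianReal (μ : ℝ) (v : NNReal) (u : ℝ) :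
    ∫ x, Complex.exp (((x - μ) * u : ℝ) * Complex.I) ∂(gaussianReal μ v) =
      Complex.exp (-(v * u ^ 2 / 2 : ℝ)) := by
  have h := charFun_gaussianReal (μ := μ) (v := v) u
  rw [charFun_apply_real] at h
  have h2 : ∀ x : ℝ, Complex.exp (((x - μ) * u : ℝ) * Complex.I) =
      Complex.exp (u * x * Complex.I) * Complex.exp (-(u * μ * Complex.I)) := by
    intro x
    rw [← Complex.exp_add]
    congr 1
    push_cast
    ring
  simp_rw [h2]
  rw [integral_mul_const, h, ← Complex.exp_add]
  congr 1
  push_cast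
  ring

/-- The characteristic function of a centred spherical normal law depends on its argument only
through the Euclidean norm, and `Aᵀ` is an isometry because the rows of `A` are orthonormal. -/
theorem map_mulVec_sphericalNormal {ι κ : Type*} [Fintype ι] [Fintype κ] [DecidableEq κ]
    (A : Matrix κ ι ℝ) (hA : A * A.transpose = 1) (μ : ι → ℝ) (σ : ℝ) :
    (sphericalNormal μ σ).map (fun x => A.mulVec (x - μ)) = sphericalNormal (0 : κ → ℝ) σ := by
  have hm : Measurable (fun x : ι → ℝ => A.mulVec (x - μ)) := by
    refine Continuous.measurable ?_
    fun_prop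
  have : IsProbabilityMeasure ((sphericalNormal μ σ).map (fun x => A.mulVec (x - μ))) :=
    Measure.isProbabilityMeasure_map hm.aemeasurable
  refine charFun_eq_pi_iff.1 fun t => ?_
  rw [charFun_apply, ← MeasurableEquiv.coe_toLp, integral_map_equiv,
    integral_map hm.aemeasurable (by
      refine Continuous.aestronglyMeasurable ?_
      simp only [MeasurableEquiv.coe_toLp]
      fun_prop)]
  set u : ι → ℝ := A.transpose.mulVec t.ofLp with hu
  have h1 : ∀ x : ι → ℝ, inner ℝ (WithLp.toLp 2 (A.mulVec (x - μ))) t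
      = ∑ i, (x i - μ i) * u i := by
    intro x
    have : inner ℝ (WithLp.toLp 2 (A.mulVec (x - μ))) t = A.mulVec (x - μ) ⬝ᵥ t.ofLp := by
      simp [PiLp.inner_apply, dotProduct, mul_comm]
    rw [this, hu, dotProduct_comm, Matrix.dotProduct_mulVec, ← Matrix.mulVec_transpose,
      dotProduct_comm]
    rfl
  have h2 : ∑ i, u i ^ 2 = ∑ j, t j ^ 2 := by
    have : u ⬝ᵥ u = t.ofLp ⬝ᵥ t.ofLp := by
      conv_lhs => rw [hu, Matrix.dotProduct_mulVec, ← Matrix.mulVec_transpose,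
        Matrix.transpose_transpose, Matrix.mulVec_mulVec, hA, Matrix.one_mulVec]
    simpa [dotProduct, sq] using this
  simp only [MeasurableEquiv.coe_toLp]
  simp_rw [h1, Complex.ofReal_sum, Finset.sum_mul, Complex.exp_sum]
  rw [integral_fintype_prod_eq_prod
    (f := fun i x => Complex.exp (((x - μ i) * u i : ℝ) * Complex.I))]
  simp_rw [charFun_centered_gaussianReal, charFun_gaussianReal]
  rw [← Complex.exp_sum, ← Complex.exp_sum]
  congr 1
  have h3 := congrArg (fun r : ℝ => (-((((σ ^ 2).toNNReal : ℝ) * r / 2 : ℝ) : ℂ))) h2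
  simp only [Finset.mul_sum, Finset.sum_div] at h3
  simp only [Pi.zero_apply, Complex.ofReal_zero, mul_zero, zero_mul, zero_sub,
    Finset.sum_neg_distrib]
  push_cast at h3 ⊢
  exact h3

/-! ### The conditionally conjugate normal model of one group -/

/-- Completing the square: a normal prior of variance `v` and a likelihood of precision `p` centred
at `b` give posterior variance `w` and mean `p v / (1 + p v) · b`; the prefactor is free of `x`. -/
theorem gaussianPDFReal_mul_exp {v w : NNReal} (hv : v ≠ 0) {p : ℝ} (hp : 0 ≤ p)
    (hw : (w : ℝ) = v / (1 + p * v)) (b x : ℝ) :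
    gaussianPDFReal 0 v x * Real.exp (-(p / 2) * (x - b) ^ 2) =
      (Real.sqrt (1 + p * v))⁻¹ * Real.exp (-(p * b ^ 2 / 2) / (1 + p * v)) *
        gaussianPDFReal (p * v / (1 + p * v) * b) w x := by
  have hv0 : (0 : ℝ) < v := by
    have : (v : ℝ) ≠ 0 := by exact_mod_cast hv
    exact lt_of_le_of_ne v.2 this.symm
  have h1 : 0 < 1 + p * v := by positivity
  unfold gaussianPDFReal
  have hs : (Real.sqrt (2 * Real.pi * w)) * Real.sqrt (1 + p * v) =
      Real.sqrt (2 * Real.pi * v) := by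
    rw [← Real.sqrt_mul (by positivity), hw]
    congr 1
    field_simp
  rw [← hs, mul_inv]
  have : Real.exp (-(x - 0) ^ 2 / (2 * v)) * Real.exp (-(p / 2) * (x - b) ^ 2) =
      Real.exp (-(p * b ^ 2 / 2) / (1 + p * v)) *
        Real.exp (-(x - p * v / (1 + p * v) * b) ^ 2 / (2 * w)) := by
    rw [← Real.exp_add, ← Real.exp_add, hw]
    congr 1
    field_simp
    ring
  linear_combination ((Real.sqrt (2 * Real.pi * w))⁻¹ * (Real.sqrt (1 + p * v))⁻¹) * this

theorem integral_gaussianPDFReal_mul_exp {v : NNReal} (hv : v ≠ 0) {p : ℝ} (hp : 0 ≤ p) (b : ℝ) :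
    ∫ x, gaussianPDFReal 0 v x * Real.exp (-(p / 2) * (x - b) ^ 2) =
      (Real.sqrt (1 + p * v))⁻¹ * Real.exp (-(p * b ^ 2 / 2) / (1 + p * v)) := by
  have hv0 : (0 : ℝ) < v := by
    have : (v : ℝ) ≠ 0 := by exact_mod_cast hv
    exact lt_of_le_of_ne v.2 this.symm
  have h1 : 0 < 1 + p * v := by positivity
  let w : NNReal := ⟨v / (1 + p * v), by positivity⟩
  have hw0 : w ≠ 0 := by
    intro h
    have : (w : ℝ) = 0 := by rw [h]; rfl
    have h2 : (0 : ℝ) < w := by change (0 : ℝ) < v / (1 + p * v); positivity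
    linarith
  simp_rw [gaussianPDFReal_mul_exp (w := w) hv hp rfl]
  rw [integral_const_mul, integral_gaussianPDFReal_eq_one _ hw0, mul_one]

theorem integral_mul_gaussianPDFReal_mul_exp {v : NNReal} (hv : v ≠ 0) {p : ℝ} (hp : 0 ≤ p)
    (b : ℝ) :
    ∫ x, x * (gaussianPDFReal 0 v x * Real.exp (-(p / 2) * (x - b) ^ 2)) =
      p * v / (1 + p * v) * b *
        ((Real.sqrt (1 + p * v))⁻¹ * Real.exp (-(p * b ^ 2 / 2) / (1 + p * v))) := by
  have hv0 : (0 : ℝ) < v := by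
    have : (v : ℝ) ≠ 0 := by exact_mod_cast hv
    exact lt_of_le_of_ne v.2 this.symm
  have h1 : 0 < 1 + p * v := by positivity
  let w : NNReal := ⟨v / (1 + p * v), by positivity⟩
  have hw0 : w ≠ 0 := by
    intro h
    have : (w : ℝ) = 0 := by rw [h]; rfl
    have h2 : (0 : ℝ) < w := by change (0 : ℝ) < v / (1 + p * v); positivity
    linarith
  simp_rw [gaussianPDFReal_mul_exp (w := w) hv hp rfl, mul_left_comm _ (_ * Real.exp _)]
  rw [integral_const_mul]
  have h2 := integral_gaussianReal_eq_integral_smul (μ := p * v / (1 + p * v) * b)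
    (f := fun x => x) hw0
  simp only [integral_id_gaussianReal, smul_eq_mul] at h2
  simp_rw [mul_comm _ (gaussianPDFReal _ _ _)]
  rw [← h2]
  ring

/-- The factor of the joint density belonging to one group, for an orthogonal design with `n`
observations and with least squares estimate `b` of the coefficients of the group, up to a
factor that is free of the parameters. -/
def groupDensity (n : ℕ) (a : ℝ) (L : ℝ → ℝ) (σ τ : ℝ) {m : ℕ} (b : Fin m → ℝ)
    (x : ℝ × (Fin m → ℝ)) : ℝ :=
  localPrior a L x.1 * ∏ j, (gaussianPDFReal 0 (x.1 * σ ^ 2 * τ ^ 2 / n).toNNReal (x.2 j) *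
    Real.exp (-((n : ℝ) / σ ^ 2 / 2) * (x.2 j - b j) ^ 2))

/-- The unnormalized posterior density of the local shrinkage parameter of a group of size `m`,
as a function of the statistic `W` of the group. -/
def localPosterior (a : ℝ) (L : ℝ → ℝ) (m : ℕ) (τ W t : ℝ) : ℝ :=
  localPrior a L t * ((Real.sqrt (1 + t * τ ^ 2))⁻¹ ^ m * Real.exp (-(W / 2) / (1 + t * τ ^ 2)))

/-! ### The normalised prior of a local shrinkage parameter. -/

section Prior

variable {a : ℝ} {L : ℝ → ℝ}

theorem IsPriorFactor.integral_pos (hL : IsPriorFactor a L) :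
    0 < ∫ s in Set.Ioi (0 : ℝ), s ^ (-a - 1) * L s := by
  have hnn : 0 ≤ᵐ[volume.restrict (Set.Ioi (0 : ℝ))] fun s => s ^ (-a - 1) * L s := by
    filter_upwards [ae_restrict_mem measurableSet_Ioi] with s hs
    exact (mul_pos (Real.rpow_pos_of_pos hs _) (hL.pos s hs)).le
  rw [setIntegral_pos_iff_support_of_nonneg_ae hnn hL.integrable]
  have : Function.support (fun s => s ^ (-a - 1) * L s) ∩ Set.Ioi 0 = Set.Ioi 0 := by
    refine Set.inter_eq_right.2 fun s hs => ?_
    exact (mul_pos (Real.rpow_pos_of_pos hs _) (hL.pos s hs)).ne'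
  rw [this]
  simp

theorem IsPriorFactor.localPrior_pos (hL : IsPriorFactor a L) {t : ℝ} (ht : 0 < t) :
    0 < localPrior a L t := by
  rw [localPrior, Set.indicator_of_mem (show t ∈ Set.Ioi (0 : ℝ) from ht)]
  exact div_pos (mul_pos (Real.rpow_pos_of_pos ht _) (hL.pos t ht)) hL.integral_pos

theorem localPrior_of_nonpos {t : ℝ} (ht : t ≤ 0) : localPrior a L t = 0 := by
  rw [localPrior, Set.indicator_of_notMem (by simpa using ht)]

theorem IsPriorFactor.localPrior_nonneg (hL : IsPriorFactor a L) (t : ℝ) :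
    0 ≤ localPrior a L t := by
  rcases lt_or_ge 0 t with ht | ht
  · exact (hL.localPrior_pos ht).le
  · rw [localPrior_of_nonpos ht]

theorem IsPriorFactor.integrable_localPrior (hL : IsPriorFactor a L) :
    Integrable (localPrior a L) :=
  (integrable_indicator_iff measurableSet_Ioi).2 (hL.integrable.div_const _)

theorem IsPriorFactor.integral_localPrior (hL : IsPriorFactor a L) :
    ∫ t, localPrior a L t = 1 := by
  unfold localPrior
  rw [integral_indicator measurableSet_Ioi, integral_div]
  exact div_self hL.integral_pos.ne'

theorem IsPriorFactor.measurable_localPrior (hL : IsPriorFactor a L) :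
    Measurable (localPrior a L) := by
  refine measurable_of_restrict_of_restrict_compl (s := Set.Ioi (0 : ℝ)) measurableSet_Ioi ?_ ?_
  · have : (Set.Ioi (0 : ℝ)).domRestrict (localPrior a L) =
        fun t : Set.Ioi (0 : ℝ) => (t : ℝ) ^ (-a - 1) * L t /
          ∫ s in Set.Ioi (0 : ℝ), s ^ (-a - 1) * L s := by
      ext t
      simp only [Set.domRestrict_apply, localPrior]
      rw [Set.indicator_of_mem t.2]
    rw [this]
    exact ((measurable_subtype_coe.pow_const _).mul hL.measurable).div_const _
  · have : (Set.Ioi (0 : ℝ))ᶜ.domRestrict (localPrior a L) = fun _ => 0 := by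
      ext t
      exact localPrior_of_nonpos (by simpa using t.2)
    rw [this]
    exact measurable_const

end Prior

/-! ### Integrating the coefficients of one group out of its density. -/

section Group

variable {n : ℕ} {a : ℝ} {L : ℝ → ℝ} {σ τ : ℝ} {m : ℕ}

theorem toNNReal_priorVariance_ne_zero (hn : n ≠ 0) (hσ : 0 < σ) (hτ : 0 < τ) {t : ℝ}
    (ht : 0 < t) : (t * σ ^ 2 * τ ^ 2 / n).toNNReal ≠ 0 := by
  have : (0 : ℝ) < n := by positivity
  have h : 0 < t * σ ^ 2 * τ ^ 2 / n := by positivity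
  simpa using h

/-- This turns `1 / (1 + p v)` into the shrinkage factor `κ = 1 / (1 + t τ²)`, free of `n` and `σ`.
-/
theorem precision_mul_priorVariance (hn : n ≠ 0) (hσ : 0 < σ) {t : ℝ} (ht : 0 < t) :
    (n : ℝ) / σ ^ 2 * ((t * σ ^ 2 * τ ^ 2 / n).toNNReal : ℝ) = t * τ ^ 2 := by
  have : (0 : ℝ) < n := by positivity
  rw [Real.coe_toNNReal _ (by positivity)]
  field_simp

/-- The prior density of the parameters `(λ², β)` of one group of an orthogonal design. -/
def groupPrior (n : ℕ) (a : ℝ) (L : ℝ → ℝ) (σ τ : ℝ) {m : ℕ} (x : ℝ × (Fin m → ℝ)) : ℝ :=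
  localPrior a L x.1 * ∏ j, gaussianPDFReal 0 (x.1 * σ ^ 2 * τ ^ 2 / n).toNNReal (x.2 j)

theorem groupDensity_eq (b : Fin m → ℝ) (x : ℝ × (Fin m → ℝ)) :
    groupDensity n a L σ τ b x = groupPrior n a L σ τ x *
      ∏ j, Real.exp (-((n : ℝ) / σ ^ 2 / 2) * (x.2 j - b j) ^ 2) := by
  rw [groupDensity, groupPrior, Finset.prod_mul_distrib]
  ring

theorem IsPriorFactor.groupPrior_nonneg (hL : IsPriorFactor a L) (x : ℝ × (Fin m → ℝ)) :
    0 ≤ groupPrior n a L σ τ x :=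
  mul_nonneg (hL.localPrior_nonneg _) (Finset.prod_nonneg fun _ _ => gaussianPDFReal_nonneg _ _ _)

theorem IsPriorFactor.measurable_groupPrior (hL : IsPriorFactor a L) :
    Measurable (groupPrior n a L σ τ (m := m)) := by
  unfold groupPrior
  refine (hL.measurable_localPrior.comp measurable_fst).mul (Finset.measurable_prod _ fun j _ => ?_)
  exact measurable_uncurry_gaussianPDFReal.comp
    (f := fun x : ℝ × (Fin m → ℝ) => ((0 : ℝ), (x.1 * σ ^ 2 * τ ^ 2 / n).toNNReal, x.2 j))
    (by fun_prop)

theorem IsPriorFactor.integrable_groupPrior (hL : IsPriorFactor a L) (hn : n ≠ 0) (hσ : 0 < σ)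
    (hτ : 0 < τ) : Integrable (groupPrior n a L σ τ (m := m)) := by
  rw [Measure.volume_eq_prod, integrable_prod_iff hL.measurable_groupPrior.aestronglyMeasurable]
  refine ⟨Eventually.of_forall fun t => ?_, ?_⟩
  · rw [volume_pi]
    exact (Integrable.fintype_prod (ι := Fin m) (f := fun _ =>
      gaussianPDFReal 0 (t * σ ^ 2 * τ ^ 2 / n).toNNReal) (μ := fun _ => volume)
      fun _ => integrable_gaussianPDFReal _ _).const_mul
        (localPrior a L t)
  · refine hL.integrable_localPrior.congr (Eventually.of_forall fun t => ?_)
    simp_rw [Real.norm_of_nonneg (hL.groupPrior_nonneg _)]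
    rcases lt_or_ge 0 t with ht | ht
    · simp only [groupPrior]
      rw [integral_const_mul, integral_fintype_prod_volume_eq_prod]
      simp [integral_gaussianPDFReal_eq_one _ (toNNReal_priorVariance_ne_zero hn hσ hτ ht)]
    · simp [groupPrior, localPrior_of_nonpos ht]

/-- Domination by a multiple of the integrable prior density. The bound is needed only for `0 <
x.1`, since the prior vanishes elsewhere. -/
theorem IsPriorFactor.integrable_mul_groupDensity (hL : IsPriorFactor a L) (hn : n ≠ 0)
    (hσ : 0 < σ) (hτ : 0 < τ) (b : Fin m → ℝ) {f : ℝ × (Fin m → ℝ) → ℝ} (hf : Measurable f)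
    {C : ℝ} (hC : ∀ x, 0 < x.1 →
      |f x * ∏ j, Real.exp (-((n : ℝ) / σ ^ 2 / 2) * (x.2 j - b j) ^ 2)| ≤ C) :
    Integrable (fun x => f x * groupDensity n a L σ τ b x) := by
  refine ((hL.integrable_groupPrior hn hσ hτ).const_mul C).mono' ?_ (Eventually.of_forall ?_)
  · simp_rw [groupDensity_eq]
    refine (hf.mul (hL.measurable_groupPrior.mul ?_)).aestronglyMeasurable
    fun_prop
  · intro x
    rcases lt_or_ge 0 x.1 with ht | ht
    · rw [groupDensity_eq, mul_left_comm, norm_mul, Real.norm_of_nonneg (hL.groupPrior_nonneg _),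
        mul_comm]
      exact mul_le_mul_of_nonneg_right (hC x ht) (hL.groupPrior_nonneg _)
    · simp [groupDensity, groupPrior, localPrior_of_nonpos ht]

theorem prod_exp_le_one (b x : Fin m → ℝ) :
    ∏ j, Real.exp (-((n : ℝ) / σ ^ 2 / 2) * (x j - b j) ^ 2) ≤ 1 := by
  refine Finset.prod_le_one (fun _ _ => (Real.exp_pos _).le) fun j _ => ?_
  rw [Real.exp_le_one_iff]
  have : 0 ≤ (n : ℝ) / σ ^ 2 / 2 * (x j - b j) ^ 2 := by positivity
  linarith

/-- Supplies the dominating constant for the posterior mean; it rests on `exp (-u) ≤ 1 / (1 + u)`.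
-/
theorem abs_mul_exp_le {p : ℝ} (hp : 0 < p) (x b : ℝ) :
    |x| * Real.exp (-p * (x - b) ^ 2) ≤ |b| + 1 + p⁻¹ := by
  have hE : Real.exp (-p * (x - b) ^ 2) ≤ (1 + p * (x - b) ^ 2)⁻¹ := by
    rw [neg_mul, Real.exp_neg]
    refine inv_anti₀ (by positivity) ?_
    linarith [Real.add_one_le_exp (p * (x - b) ^ 2)]
  have h1 : 0 < 1 + p * (x - b) ^ 2 := by positivity
  refine (mul_le_mul_of_nonneg_left hE (abs_nonneg x)).trans ?_
  rw [← div_eq_mul_inv, div_le_iff₀ h1]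
  have h2 : |x| ≤ |b| + |x - b| := by
    have := abs_add_le b (x - b)
    simpa using this
  have h3 : |x - b| ≤ 1 + (x - b) ^ 2 := by
    rw [← sq_abs (x - b)]
    nlinarith [sq_nonneg (|x - b| - 1), abs_nonneg (x - b)]
  have h4 : p⁻¹ * (1 + p * (x - b) ^ 2) = p⁻¹ + (x - b) ^ 2 := by field_simp
  have h5 : 0 ≤ (|b| + 1) * (p * (x - b) ^ 2) := by positivity
  have h6 : 0 < p⁻¹ := by positivity
  nlinarith

theorem IsPriorFactor.integrable_comp_fst_mul_groupDensity (hL : IsPriorFactor a L) (hn : n ≠ 0)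
    (hσ : 0 < σ) (hτ : 0 < τ) (b : Fin m → ℝ) {φ : ℝ → ℝ} (hφ : Measurable φ)
    (hφ1 : ∀ t, 0 < t → |φ t| ≤ 1) :
    Integrable (fun x : ℝ × (Fin m → ℝ) => φ x.1 * groupDensity n a L σ τ b x) := by
  refine hL.integrable_mul_groupDensity hn hσ hτ b (hφ.comp measurable_fst) (C := 1) fun x hx => ?_
  rw [abs_mul, abs_of_nonneg (Finset.prod_nonneg fun _ _ => (Real.exp_pos _).le)]
  exact mul_le_one₀ (hφ1 _ hx) (Finset.prod_nonneg fun _ _ => (Real.exp_pos _).le)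
    (prod_exp_le_one _ _)

theorem IsPriorFactor.integrable_coord_mul_groupDensity (hL : IsPriorFactor a L) (hn : n ≠ 0)
    (hσ : 0 < σ) (hτ : 0 < τ) (b : Fin m → ℝ) (j : Fin m) :
    Integrable (fun x : ℝ × (Fin m → ℝ) => x.2 j * groupDensity n a L σ τ b x) := by
  have hp : 0 < (n : ℝ) / σ ^ 2 / 2 := by
    have : (0 : ℝ) < n := by positivity
    positivity
  refine hL.integrable_mul_groupDensity hn hσ hτ b (f := fun x => x.2 j) (by fun_prop)
    (C := |b j| + 1 + ((n : ℝ) / σ ^ 2 / 2)⁻¹) fun x hx => ?_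
  rw [abs_mul, abs_of_nonneg (Finset.prod_nonneg fun _ _ => (Real.exp_pos _).le)]
  refine le_trans ?_ (abs_mul_exp_le hp (x.2 j) (b j))
  refine mul_le_mul_of_nonneg_left ?_ (abs_nonneg _)
  rw [← Finset.mul_prod_erase _ _ (Finset.mem_univ j)]
  refine mul_le_of_le_one_right (Real.exp_pos _).le ?_
  refine Finset.prod_le_one (fun _ _ => (Real.exp_pos _).le) fun i _ => ?_
  rw [Real.exp_le_one_iff]
  have : 0 ≤ (n : ℝ) / σ ^ 2 / 2 * (x.2 i - b i) ^ 2 := by positivity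
  linarith

theorem prod_posterior_factor (b : Fin m → ℝ) (t : ℝ) :
    ∏ j, ((Real.sqrt (1 + t * τ ^ 2))⁻¹ *
        Real.exp (-((n : ℝ) / σ ^ 2 * b j ^ 2 / 2) / (1 + t * τ ^ 2))) =
      (Real.sqrt (1 + t * τ ^ 2))⁻¹ ^ m *
        Real.exp (-(((n : ℝ) / σ ^ 2 * ∑ j, b j ^ 2) / 2) / (1 + t * τ ^ 2)) := by
  rw [Finset.prod_mul_distrib, Finset.prod_const, Finset.card_univ, Fintype.card_fin,
    ← Real.exp_sum, ← Finset.sum_div, Finset.sum_neg_distrib, ← Finset.sum_div, Finset.mul_sum]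

theorem integral_groupDensity (hn : n ≠ 0) (hσ : 0 < σ) (hτ : 0 < τ) (b : Fin m → ℝ) (t : ℝ) :
    ∫ β, groupDensity n a L σ τ b (t, β) =
      localPosterior a L m τ ((n : ℝ) / σ ^ 2 * ∑ j, b j ^ 2) t := by
  rcases lt_or_ge 0 t with ht | ht
  · simp only [groupDensity, localPosterior]
    rw [integral_const_mul, integral_fintype_prod_volume_eq_prod
      (f := fun j x => gaussianPDFReal 0 (t * σ ^ 2 * τ ^ 2 / n).toNNReal x *
        Real.exp (-((n : ℝ) / σ ^ 2 / 2) * (x - b j) ^ 2))]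
    simp_rw [integral_gaussianPDFReal_mul_exp (toNNReal_priorVariance_ne_zero hn hσ hτ ht)
      (show 0 ≤ (n : ℝ) / σ ^ 2 by positivity), precision_mul_priorVariance hn hσ ht]
    rw [prod_posterior_factor]
  · simp [groupDensity, localPosterior, localPrior_of_nonpos ht]

theorem integral_coord_mul_groupDensity (hn : n ≠ 0) (hσ : 0 < σ) (hτ : 0 < τ) (b : Fin m → ℝ)
    (t : ℝ) (i : Fin m) :
    ∫ β : Fin m → ℝ, β i * groupDensity n a L σ τ b (t, β) =
      b i * ((1 - 1 / (1 + t * τ ^ 2)) *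
        localPosterior a L m τ ((n : ℝ) / σ ^ 2 * ∑ j, b j ^ 2) t) := by
  rcases lt_or_ge 0 t with ht | ht
  · simp only [groupDensity, localPosterior]
    -- The factor `β i` is absorbed into the `i`-th term of the product, so that the integral still
    -- splits over coordinates.
    have h : ∀ β : Fin m → ℝ, β i * (localPrior a L t * ∏ j,
        (gaussianPDFReal 0 (t * σ ^ 2 * τ ^ 2 / n).toNNReal (β j) *
          Real.exp (-((n : ℝ) / σ ^ 2 / 2) * (β j - b j) ^ 2))) =
        localPrior a L t * ∏ j, ((if j = i then β j else 1) *
        (gaussianPDFReal 0 (t * σ ^ 2 * τ ^ 2 / n).toNNReal (β j) *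
          Real.exp (-((n : ℝ) / σ ^ 2 / 2) * (β j - b j) ^ 2))) := by
      intro β
      rw [Finset.prod_mul_distrib (f := fun j => if j = i then β j else 1),
        Finset.prod_ite_eq' Finset.univ i β, if_pos (Finset.mem_univ i)]
      ring
    simp_rw [h]
    have hint : ∀ j, ∫ x, (if j = i then x else 1) *
        (gaussianPDFReal 0 (t * σ ^ 2 * τ ^ 2 / n).toNNReal x *
          Real.exp (-((n : ℝ) / σ ^ 2 / 2) * (x - b j) ^ 2)) =
        (if j = i then (1 - 1 / (1 + t * τ ^ 2)) * b j else 1) *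
          ((Real.sqrt (1 + t * τ ^ 2))⁻¹ *
            Real.exp (-((n : ℝ) / σ ^ 2 * b j ^ 2 / 2) / (1 + t * τ ^ 2))) := by
      intro j
      split_ifs with hj
      · rw [integral_mul_gaussianPDFReal_mul_exp (toNNReal_priorVariance_ne_zero hn hσ hτ ht)
          (show 0 ≤ (n : ℝ) / σ ^ 2 by positivity), precision_mul_priorVariance hn hσ ht]
        have : 1 + t * τ ^ 2 ≠ 0 := by positivity
        congr 2
        field_simp
        ring
      · simp_rw [one_mul]
        rw [integral_gaussianPDFReal_mul_exp (toNNReal_priorVariance_ne_zero hn hσ hτ ht)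
          (show 0 ≤ (n : ℝ) / σ ^ 2 by positivity), precision_mul_priorVariance hn hσ ht]
    rw [integral_const_mul, integral_fintype_prod_volume_eq_prod
      (f := fun j x => (if j = i then x else 1) *
        (gaussianPDFReal 0 (t * σ ^ 2 * τ ^ 2 / n).toNNReal x *
          Real.exp (-((n : ℝ) / σ ^ 2 / 2) * (x - b j) ^ 2)))]
    simp_rw [hint]
    rw [Finset.prod_mul_distrib, Finset.prod_ite_eq' Finset.univ i
      (fun j => (1 - 1 / (1 + t * τ ^ 2)) * b j), if_pos (Finset.mem_univ i), prod_posterior_factor]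
    ring
  · simp [groupDensity, localPosterior, localPrior_of_nonpos ht]

theorem IsPriorFactor.integral_comp_fst_mul_groupDensity (hL : IsPriorFactor a L) (hn : n ≠ 0)
    (hσ : 0 < σ) (hτ : 0 < τ) (b : Fin m → ℝ) {φ : ℝ → ℝ} (hφ : Measurable φ)
    (hφ1 : ∀ t, 0 < t → |φ t| ≤ 1) :
    ∫ x : ℝ × (Fin m → ℝ), φ x.1 * groupDensity n a L σ τ b x =
      ∫ t, φ t * localPosterior a L m τ ((n : ℝ) / σ ^ 2 * ∑ j, b j ^ 2) t := by
  have h := hL.integrable_comp_fst_mul_groupDensity hn hσ hτ b hφ hφ1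
  rw [Measure.volume_eq_prod] at h ⊢
  rw [integral_prod _ h]
  simp_rw [integral_const_mul, integral_groupDensity hn hσ hτ]

theorem IsPriorFactor.integral_coord_mul_groupDensity (hL : IsPriorFactor a L) (hn : n ≠ 0)
    (hσ : 0 < σ) (hτ : 0 < τ) (b : Fin m → ℝ) (i : Fin m) :
    ∫ x : ℝ × (Fin m → ℝ), x.2 i * groupDensity n a L σ τ b x =
      b i * ∫ t, (1 - 1 / (1 + t * τ ^ 2)) *
        localPosterior a L m τ ((n : ℝ) / σ ^ 2 * ∑ j, b j ^ 2) t := by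
  have h := hL.integrable_coord_mul_groupDensity hn hσ hτ b i
  rw [Measure.volume_eq_prod] at h ⊢
  rw [integral_prod _ h]
  simp_rw [GroupHT.integral_coord_mul_groupDensity hn hσ hτ]
  rw [integral_const_mul]

end Group

/-! ### Positivity and integrability of the posterior of `λ²`. -/

section LocalPosterior

variable {a : ℝ} {L : ℝ → ℝ} {m : ℕ} {τ W : ℝ}

theorem IsPriorFactor.measurable_localPosterior (hL : IsPriorFactor a L) :
    Measurable (localPosterior a L m τ W) := by
  unfold localPosterior
  exact hL.measurable_localPrior.mul (by fun_prop)

theorem IsPriorFactor.localPosterior_nonneg (hL : IsPriorFactor a L) (t : ℝ) :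
    0 ≤ localPosterior a L m τ W t :=
  mul_nonneg (hL.localPrior_nonneg t) (by positivity)

theorem IsPriorFactor.localPosterior_pos (hL : IsPriorFactor a L) {t : ℝ} (ht : 0 < t) :
    0 < localPosterior a L m τ W t :=
  mul_pos (hL.localPrior_pos ht) (by positivity)

theorem IsPriorFactor.localPosterior_le (hL : IsPriorFactor a L) {t : ℝ} :
    localPosterior a L m τ W t ≤ localPrior a L t * Real.exp (-(W / 2) / (1 + t * τ ^ 2)) := by
  rcases lt_or_ge 0 t with ht | ht
  · rw [localPosterior]
    refine mul_le_mul_of_nonneg_left ?_ (hL.localPrior_nonneg t)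
    refine mul_le_of_le_one_left (Real.exp_pos _).le ?_
    refine pow_le_one₀ (by positivity) (inv_le_one_of_one_le₀ ?_)
    rw [Real.one_le_sqrt]
    have : 0 ≤ t * τ ^ 2 := by positivity
    linarith
  · simp [localPosterior, localPrior_of_nonpos ht]

theorem IsPriorFactor.localPosterior_le_localPrior (hL : IsPriorFactor a L) (hW : 0 ≤ W) {t : ℝ} :
    localPosterior a L m τ W t ≤ localPrior a L t := by
  rcases lt_or_ge 0 t with ht | ht
  · refine hL.localPosterior_le.trans (mul_le_of_le_one_right (hL.localPrior_nonneg t) ?_)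
    rw [Real.exp_le_one_iff, neg_div]
    have : 0 ≤ W / 2 / (1 + t * τ ^ 2) := by positivity
    linarith
  · simp [localPosterior, localPrior_of_nonpos ht]

theorem IsPriorFactor.integrable_localPosterior (hL : IsPriorFactor a L) (hW : 0 ≤ W) :
    Integrable (localPosterior a L m τ W) :=
  hL.integrable_localPrior.mono' hL.measurable_localPosterior.aestronglyMeasurable
    (Eventually.of_forall fun t => by
      rw [Real.norm_of_nonneg (hL.localPosterior_nonneg t)]
      exact hL.localPosterior_le_localPrior hW)

theorem IsPriorFactor.integral_localPosterior_pos (hL : IsPriorFactor a L) (hW : 0 ≤ W) :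
    0 < ∫ t, localPosterior a L m τ W t := by
  rw [integral_pos_iff_support_of_nonneg hL.localPosterior_nonneg
    (hL.integrable_localPosterior hW)]
  have : Set.Ioi (0 : ℝ) ⊆ Function.support (localPosterior a L m τ W) := fun t ht =>
    (hL.localPosterior_pos ht).ne'
  refine lt_of_lt_of_le ?_ (measure_mono this)
  simp

end LocalPosterior

/-! ### Orthogonal designs: factorisation of the posterior over groups. -/

theorem inv_smul_one {ι : Type*} [Fintype ι] [DecidableEq ι] {v : ℝ} (hv : v ≠ 0) :
    (v • (1 : Matrix ι ι ℝ))⁻¹ = v⁻¹ • 1 := by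
  refine Matrix.inv_eq_left_inv ?_
  rw [smul_mul_smul_comm, inv_mul_cancel₀ hv, mul_one, one_smul]

theorem mvnDensity_smul_one {ι : Type*} [Fintype ι] [DecidableEq ι] (μ x : ι → ℝ) {v : ℝ}
    (hv : 0 < v) : mvnDensity μ (v • (1 : Matrix ι ι ℝ)) x =
      ∏ i, gaussianPDFReal (μ i) v.toNNReal (x i) := by
  unfold mvnDensity gaussianPDFReal
  rw [inv_smul_one hv.ne', Matrix.smul_mulVec, Matrix.one_mulVec, Matrix.det_smul, Matrix.det_one, mul_one,
    Finset.prod_mul_distrib, Finset.prod_const, ← Real.exp_sum, Real.coe_toNNReal _ hv.le,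
    ← mul_pow, Finset.card_univ]
  congr 1
  · rw [inv_pow, ← Real.sqrt_sq (show 0 ≤ Real.sqrt (2 * Real.pi * v) ^ Fintype.card ι by positivity),
      ← pow_mul, mul_comm (Fintype.card ι), pow_mul, Real.sq_sqrt (by positivity)]
  · congr 1
    simp only [dotProduct, Pi.smul_apply, Pi.sub_apply, smul_eq_mul, Finset.mul_sum]
    refine Finset.sum_congr rfl fun i _ => ?_
    field_simp

namespace Design

variable {n : ℕ} {D : Design n}

theorem IsOrthogonal.leastSquares_eq (hD : D.IsOrthogonal) (hn : n ≠ 0) (y : Fin n → ℝ)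
    (g : Fin D.G) (j : Fin (D.m g)) :
    D.leastSquares y g j = (n : ℝ)⁻¹ * D.X.transpose.mulVec y ⟨g, j⟩ := by
  have hn' : (n : ℝ) ≠ 0 := by exact_mod_cast hn
  rw [leastSquares, hD, inv_smul_one hn', Matrix.smul_mulVec, Matrix.one_mulVec]
  rfl

theorem IsOrthogonal.block_transpose_mul_block (hD : D.IsOrthogonal) (g : Fin D.G) :
    (D.block g).transpose * D.block g = (n : ℝ) • 1 := by
  ext i j
  have h := congrFun (congrFun hD ⟨g, i⟩) ⟨g, j⟩
  simp only [Matrix.mul_apply, Matrix.transpose_apply, Matrix.smul_apply] at h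
  simp only [Matrix.mul_apply, Matrix.transpose_apply, block, Matrix.submatrix_apply, id,
    Matrix.smul_apply, h]
  by_cases hij : i = j
  · subst hij; simp
  · rw [Matrix.one_apply_ne hij, Matrix.one_apply_ne]
    simpa using hij

/-- Pythagoras: the residual sum of squares, which is free of `β`, plus the squared distance from
the fit to the least squares fit. -/
theorem IsOrthogonal.dotProduct_sub_fit (hD : D.IsOrthogonal) (hn : n ≠ 0) (y : Fin n → ℝ)
    (β : D.Coef) :
    ∑ i, (y i - D.fit β i) ^ 2 = (∑ i, y i ^ 2 - n * ∑ g, ∑ j, D.leastSquares y g j ^ 2) +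
      n * ∑ g, ∑ j, (β g j - D.leastSquares y g j) ^ 2 := by
  have hn' : (n : ℝ) ≠ 0 := by exact_mod_cast hn
  set z : ((g : Fin D.G) × Fin (D.m g)) → ℝ := fun k => β k.1 k.2 with hz
  have h1 : D.fit β ⬝ᵥ D.fit β = n * (z ⬝ᵥ z) := by
    change D.X.mulVec z ⬝ᵥ D.X.mulVec z = _
    rw [Matrix.dotProduct_mulVec, ← Matrix.mulVec_transpose, Matrix.mulVec_mulVec, hD,
      Matrix.smul_mulVec, Matrix.one_mulVec, smul_dotProduct, smul_eq_mul]
  have h2 : y ⬝ᵥ D.fit β = D.X.transpose.mulVec y ⬝ᵥ z := by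
    change y ⬝ᵥ D.X.mulVec z = _
    rw [Matrix.dotProduct_mulVec, ← Matrix.mulVec_transpose]
  have h3 : D.X.transpose.mulVec y ⬝ᵥ z = n * ∑ g, ∑ j, D.leastSquares y g j * β g j := by
    simp_rw [dotProduct, hD.leastSquares_eq hn, Fintype.sum_sigma, mul_assoc, ← Finset.mul_sum]
    rw [← mul_assoc, mul_inv_cancel₀ hn', one_mul]
  have h4 : z ⬝ᵥ z = ∑ g, ∑ j, β g j ^ 2 := by
    simp only [dotProduct, Fintype.sum_sigma, hz, sq]
  have h5 : ∑ i, (y i - D.fit β i) ^ 2 =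
      ∑ i, y i ^ 2 - 2 * (y ⬝ᵥ D.fit β) + D.fit β ⬝ᵥ D.fit β := by
    simp only [dotProduct, Finset.mul_sum, ← Finset.sum_sub_distrib, ← Finset.sum_add_distrib]
    exact Finset.sum_congr rfl fun i _ => by ring
  have h6 : ∑ g, ∑ j, (β g j - D.leastSquares y g j) ^ 2 =
      ∑ g, ∑ j, β g j ^ 2 - 2 * ∑ g, ∑ j, D.leastSquares y g j * β g j +
        ∑ g, ∑ j, D.leastSquares y g j ^ 2 := by
    simp only [Finset.mul_sum, ← Finset.sum_sub_distrib, ← Finset.sum_add_distrib]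
    exact Finset.sum_congr rfl fun g _ => Finset.sum_congr rfl fun j _ => by ring
  rw [h5, h1, h2, h3, h4, h6]
  ring

variable {a : ℝ} {L : ℝ → ℝ} {σ τ : ℝ}

/-- The constant collects all that depends on the data alone; it cancels in Bayes' formula, so only
`C ≠ 0` matters. -/
theorem IsOrthogonal.exists_jointDensity_eq (hD : D.IsOrthogonal) (hn : n ≠ 0) (hσ : 0 < σ)
    (hτ : 0 < τ) (y : Fin n → ℝ) : ∃ C : ℝ, C ≠ 0 ∧ ∀ θ : D.Param,
      D.jointDensity a L σ τ y θ = C * ∏ g, groupDensity n a L σ τ (D.leastSquares y g) (θ g) := by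
  have hn' : (0 : ℝ) < n := by positivity
  refine ⟨((Real.sqrt (2 * Real.pi * σ ^ 2))⁻¹) ^ n * Real.exp (-(1 / (2 * σ ^ 2)) *
    (∑ i, y i ^ 2 - n * ∑ g, ∑ j, D.leastSquares y g j ^ 2)), by positivity, fun θ => ?_⟩
  have hσ2 : 0 < σ ^ 2 := by positivity
  rw [jointDensity, mvnDensity_smul_one _ _ hσ2]
  have h1 : ∀ g, localPrior a L (θ g).1 * mvnDensity 0
      (((θ g).1 * σ ^ 2 * τ ^ 2) • ((D.block g).transpose * D.block g)⁻¹) (θ g).2 =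
      groupPrior n a L σ τ (θ g) := by
    intro g
    -- For `λ² ≤ 0` the covariance matrix is not positive definite, but the prior factor is zero
    -- there.
    rcases lt_or_ge 0 (θ g).1 with ht | ht
    · rw [hD.block_transpose_mul_block, inv_smul_one hn'.ne', smul_smul, ← div_eq_mul_inv,
        mvnDensity_smul_one _ _ (by positivity)]
      rfl
    · simp [groupPrior, localPrior_of_nonpos ht]
  simp_rw [h1, groupDensity_eq]
  rw [Finset.prod_mul_distrib]
  have h2 : ∏ i, gaussianPDFReal (D.fit (fun g => (θ g).2) i) (σ ^ 2).toNNReal (y i) =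
      ((Real.sqrt (2 * Real.pi * σ ^ 2))⁻¹) ^ n * Real.exp (-(1 / (2 * σ ^ 2)) *
        ∑ i, (y i - D.fit (fun g => (θ g).2) i) ^ 2) := by
    simp only [gaussianPDFReal]
    rw [Finset.prod_mul_distrib, Finset.prod_const, Finset.card_univ, Fintype.card_fin,
      ← Real.exp_sum, Real.coe_toNNReal _ hσ2.le, Finset.mul_sum]
    congr 2
    refine Finset.sum_congr rfl fun i _ => ?_
    ring
  rw [h2, hD.dotProduct_sub_fit hn, mul_add, Real.exp_add]
  have h3 : ∏ g, ∏ j, Real.exp (-((n : ℝ) / σ ^ 2 / 2) * ((θ g).2 j - D.leastSquares y g j) ^ 2) =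
      Real.exp (-(1 / (2 * σ ^ 2)) * (n * ∑ g, ∑ j, ((θ g).2 j - D.leastSquares y g j) ^ 2)) := by
    simp_rw [← Real.exp_sum]
    congr 1
    simp_rw [← Finset.mul_sum]
    ring
  rw [h3]
  ring

theorem IsOrthogonal.W_eq (hD : D.IsOrthogonal) (hn : n ≠ 0) (y : Fin n → ℝ) (g : Fin D.G) :
    D.W σ y g = n / σ ^ 2 * ∑ j, D.leastSquares y g j ^ 2 := by
  have hn' : (n : ℝ) ≠ 0 := by exact_mod_cast hn
  have hQ : D.Q g = 1 := by
    rw [Q, hD.block_transpose_mul_block, smul_smul, inv_mul_cancel₀ hn', one_smul]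
  rw [W, hQ, Matrix.one_mulVec]
  simp only [dotProduct, ← sq]
  ring

/-- Numerator and denominator are products of integrals over the groups; those of the other groups
agree, are positive, and cancel. The product formula for integrals requires no integrability, hence
`f` is arbitrary. -/
theorem IsOrthogonal.posteriorExp_eq (hD : D.IsOrthogonal) (hL : IsPriorFactor a L) (hn : n ≠ 0)
    (hσ : 0 < σ) (hτ : 0 < τ) (y : Fin n → ℝ) (g : Fin D.G)
    (f : ℝ × (Fin (D.m g) → ℝ) → ℝ) :
    D.posteriorExp a L σ τ y (fun θ => f (θ g)) =
      (∫ x, f x * groupDensity n a L σ τ (D.leastSquares y g) x) /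
        ∫ t, localPosterior a L (D.m g) τ (D.W σ y g) t := by
  obtain ⟨C, hC, hj⟩ := hD.exists_jointDensity_eq (a := a) (L := L) hn hσ hτ y
  have hI : ∀ i : Fin D.G, ∫ x, groupDensity n a L σ τ (D.leastSquares y i) x =
      ∫ t, localPosterior a L (D.m i) τ (D.W σ y i) t := by
    intro i
    have := hL.integral_comp_fst_mul_groupDensity hn hσ hτ (D.leastSquares y i)
      (φ := fun _ => 1) measurable_const (by simp)
    rw [hD.W_eq hn]
    simpa using this
  have hpos : ∀ i : Fin D.G, 0 < ∫ t, localPosterior a L (D.m i) τ (D.W σ y i) t := fun i =>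
    hL.integral_localPosterior_pos (by rw [hD.W_eq hn]; positivity)
  have hden : ∫ θ : D.Param, D.jointDensity a L σ τ y θ =
      C * ∏ i, ∫ t, localPosterior a L (D.m i) τ (D.W σ y i) t := by
    simp_rw [hj]
    rw [integral_const_mul, integral_fintype_prod_volume_eq_prod
      (f := fun i x => groupDensity n a L σ τ (D.leastSquares y i) x)]
    simp_rw [hI]
  have hnum : ∫ θ : D.Param, f (θ g) * D.jointDensity a L σ τ y θ =
      C * ((∫ x, f x * groupDensity n a L σ τ (D.leastSquares y g) x) *
        ∏ i ∈ Finset.univ.erase g, ∫ t, localPosterior a L (D.m i) τ (D.W σ y i) t) := by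
    let F : (i : Fin D.G) → ℝ × (Fin (D.m i) → ℝ) → ℝ := Function.update
      (fun i x => groupDensity n a L σ τ (D.leastSquares y i) x) g
      (fun x => f x * groupDensity n a L σ τ (D.leastSquares y g) x)
    have hF : ∀ θ : D.Param, f (θ g) * D.jointDensity a L σ τ y θ = C * ∏ i, F i (θ i) := by
      intro θ
      rw [hj, ← Finset.mul_prod_erase _ _ (Finset.mem_univ g),
        ← Finset.mul_prod_erase _ (fun i => F i (θ i)) (Finset.mem_univ g)]
      have h1 : F g (θ g) = f (θ g) * groupDensity n a L σ τ (D.leastSquares y g) (θ g) := by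
        simp [F]
      have h2 : ∏ i ∈ Finset.univ.erase g, F i (θ i) = ∏ i ∈ Finset.univ.erase g,
          groupDensity n a L σ τ (D.leastSquares y i) (θ i) :=
        Finset.prod_congr rfl fun i hi => by simp [F, Finset.ne_of_mem_erase hi]
      rw [h1, h2]
      ring
    simp_rw [hF]
    rw [integral_const_mul, integral_fintype_prod_volume_eq_prod,
      ← Finset.mul_prod_erase _ _ (Finset.mem_univ g)]
    congr 2
    · simp [F]
    · refine Finset.prod_congr rfl fun i hi => ?_
      rw [← hI]
      simp [F, Finset.ne_of_mem_erase hi]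
  rw [posteriorExp, hden, hnum, ← Finset.mul_prod_erase _ _ (Finset.mem_univ g)]
  have hne : ∏ i ∈ Finset.univ.erase g, ∫ t, localPosterior a L (D.m i) τ (D.W σ y i) t ≠ 0 :=
    Finset.prod_ne_zero_iff.2 fun i _ => (hpos i).ne'
  have := (hpos g).ne'
  field_simp

theorem IsOrthogonal.shrinkWeight_eq (hD : D.IsOrthogonal) (hL : IsPriorFactor a L) (hn : n ≠ 0)
    (hσ : 0 < σ) (hτ : 0 < τ) (y : Fin n → ℝ) (g : Fin D.G) :
    D.shrinkWeight a L σ τ y g =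
      (∫ t, (1 - 1 / (1 + t * τ ^ 2)) * localPosterior a L (D.m g) τ (D.W σ y g) t) /
        ∫ t, localPosterior a L (D.m g) τ (D.W σ y g) t := by
  rw [shrinkWeight, hD.posteriorExp_eq hL hn hσ hτ y g
    (fun x : ℝ × (Fin (D.m g) → ℝ) => 1 - 1 / (1 + x.1 * τ ^ 2)),
    hL.integral_comp_fst_mul_groupDensity hn hσ hτ _ (φ := fun t => 1 - 1 / (1 + t * τ ^ 2))
      (by fun_prop) ?_, hD.W_eq hn]
  intro t ht
  have h1 : 1 ≤ 1 + t * τ ^ 2 := by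
    have : 0 < t * τ ^ 2 := by positivity
    linarith
  have h2 : 1 / (1 + t * τ ^ 2) ≤ 1 := (div_le_one (by linarith)).2 h1
  have h3 : 0 < 1 / (1 + t * τ ^ 2) := by positivity
  rw [abs_le]
  constructor <;> linarith

/-- The conditional mean given `λ²` is `1 - κ` times least squares; averaging over `λ²` gives one
weight for all coordinates of the group. -/
theorem IsOrthogonal.posteriorMean_eq (hD : D.IsOrthogonal) (hL : IsPriorFactor a L) (hn : n ≠ 0)
    (hσ : 0 < σ) (hτ : 0 < τ) (y : Fin n → ℝ) (g : Fin D.G) (j : Fin (D.m g)) :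
    D.posteriorMean a L σ τ y g j = D.shrinkWeight a L σ τ y g * D.leastSquares y g j := by
  rw [posteriorMean, hD.posteriorExp_eq hL hn hσ hτ y g
    (fun x : ℝ × (Fin (D.m g) → ℝ) => x.2 j), hD.shrinkWeight_eq hL hn hσ hτ,
    hL.integral_coord_mul_groupDensity hn hσ hτ, hD.W_eq hn]
  ring

end Design

/-! ### Concentration of the shrinkage weight at one -/

section Concentration

variable {a : ℝ} {L : ℝ → ℝ} {m : ℕ}

/-- The posterior mean of the shrinkage factor `κ`. -/
def meanKappa (a : ℝ) (L : ℝ → ℝ) (m : ℕ) (τ W : ℝ) : ℝ :=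
  (∫ t, 1 / (1 + t * τ ^ 2) * localPosterior a L m τ W t) / ∫ t, localPosterior a L m τ W t

theorem IsPriorFactor.integrable_kappa_mul (hL : IsPriorFactor a L) {τ W : ℝ} (hW : 0 ≤ W) :
    Integrable (fun t => 1 / (1 + t * τ ^ 2) * localPosterior a L m τ W t) := by
  refine (hL.integrable_localPosterior (m := m) (τ := τ) hW).mono'
    (Measurable.mul (by fun_prop) hL.measurable_localPosterior).aestronglyMeasurable
    (Eventually.of_forall fun t => ?_)
  rcases lt_or_ge 0 t with ht | ht
  · have h0 : 0 < 1 / (1 + t * τ ^ 2) := by positivity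
    rw [Real.norm_of_nonneg (mul_nonneg h0.le (hL.localPosterior_nonneg t))]
    refine mul_le_of_le_one_left (hL.localPosterior_nonneg t) ((div_le_one (by positivity)).2 ?_)
    have : 0 ≤ t * τ ^ 2 := by positivity
    linarith
  · simp [localPosterior, localPrior_of_nonpos ht]

theorem IsPriorFactor.one_sub_meanKappa (hL : IsPriorFactor a L) {τ W : ℝ} (hW : 0 ≤ W) :
    (∫ t, (1 - 1 / (1 + t * τ ^ 2)) * localPosterior a L m τ W t) /
      ∫ t, localPosterior a L m τ W t = 1 - meanKappa a L m τ W := by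
  have hpos := hL.integral_localPosterior_pos (m := m) (τ := τ) hW
  simp_rw [sub_mul, one_mul]
  rw [integral_sub (hL.integrable_localPosterior hW) (hL.integrable_kappa_mul hW), sub_div,
    div_self hpos.ne', meanKappa]

theorem IsPriorFactor.meanKappa_nonneg (hL : IsPriorFactor a L) (τ W : ℝ) :
    0 ≤ meanKappa a L m τ W := by
  refine div_nonneg (integral_nonneg fun t => ?_) (integral_nonneg hL.localPosterior_nonneg)
  rcases lt_or_ge 0 t with ht | ht
  · exact mul_nonneg (by positivity) (hL.localPosterior_nonneg t)
  · simp [localPosterior, localPrior_of_nonpos ht]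

/-- Where `κ ≤ η`, the integrand is at most `η` times the posterior density. Where `κ ≥ η`, its
likelihood factor is at most `exp (-W η / 2)`, and the prior has total mass one. -/
theorem IsPriorFactor.meanKappa_le (hL : IsPriorFactor a L) {τ W η : ℝ} (hW : 0 ≤ W)
    (hη : 0 ≤ η) : meanKappa a L m τ W ≤
      η + Real.exp (-(W * η / 2)) / ∫ t, localPosterior a L m τ W t := by
  have hpos := hL.integral_localPosterior_pos (m := m) (τ := τ) hW
  rw [meanKappa, div_le_iff₀ hpos, add_mul, div_mul_cancel₀ _ hpos.ne']
  have hle : ∫ t, 1 / (1 + t * τ ^ 2) * localPosterior a L m τ W t ≤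
      ∫ t, (η * localPosterior a L m τ W t + Real.exp (-(W * η / 2)) * localPrior a L t) := by
    refine integral_mono (hL.integrable_kappa_mul hW) (((hL.integrable_localPosterior hW).const_mul
      _).add (hL.integrable_localPrior.const_mul _)) fun t => ?_
    rcases lt_or_ge 0 t with ht | ht
    · have h1 : 0 < 1 + t * τ ^ 2 := by positivity
      have hp := hL.localPosterior_nonneg (m := m) (τ := τ) (W := W) t
      have hq := hL.localPrior_nonneg t
      rcases le_total (1 / (1 + t * τ ^ 2)) η with h | h
      · have := mul_le_mul_of_nonneg_right h hp
        have h2 : 0 ≤ Real.exp (-(W * η / 2)) * localPrior a L t := by positivity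
        dsimp only
        linarith
      · have h2 : 1 / (1 + t * τ ^ 2) ≤ 1 := by
          refine (div_le_one h1).2 ?_
          have : 0 ≤ t * τ ^ 2 := by positivity
          linarith
        have h3 : Real.exp (-(W / 2) / (1 + t * τ ^ 2)) ≤ Real.exp (-(W * η / 2)) := by
          rw [Real.exp_le_exp]
          have h4 := mul_le_mul_of_nonneg_left h (show 0 ≤ W / 2 by positivity)
          have h5 : -(W / 2) / (1 + t * τ ^ 2) = -(W / 2 * (1 / (1 + t * τ ^ 2))) := by ring
          rw [h5]
          linarith
        have h6 := hL.localPosterior_le (m := m) (τ := τ) (W := W) (t := t)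
        have h7 := mul_le_mul_of_nonneg_left h3 hq
        have h8 := mul_le_mul_of_nonneg_right h2 hp
        have h9 : 0 ≤ η * localPosterior a L m τ W t := by positivity
        dsimp only
        linarith
    · simp [localPosterior, localPrior_of_nonpos ht]
  rw [integral_add ((hL.integrable_localPosterior hW).const_mul _)
    (hL.integrable_localPrior.const_mul _), integral_const_mul, integral_const_mul,
    hL.integral_localPrior, mul_one] at hle
  exact hle

/-- The integral is bounded below on the window `W ≤ t τ² ≤ 2 W`, of length at least one. There the
exponential stays bounded below, and `τ ≥ c / W` gives `t ≤ 2 W³ / c²`, so the prior loses only a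
power of `W`. The exponent is crude, but any power suffices. -/
theorem IsPriorFactor.exists_le_integral_localPosterior (hL : IsPriorFactor a L)
    (hLb : IsBoundedFactor L) (ha : 0 < a) (m : ℕ) {c : ℝ} (hc : 0 < c) :
    ∃ B W₀ : ℝ, 0 < B ∧ 1 ≤ W₀ ∧ ∀ W τ, W₀ ≤ W → c / W ≤ τ → τ ≤ 1 →
      B * W ^ (-(3 * (a + 1) + m)) ≤ ∫ t, localPosterior a L m τ W t := by
  obtain ⟨c₀, t₀, hc₀, ht₀, hlow⟩ := hLb.lower
  set K := ∫ s in Set.Ioi (0 : ℝ), s ^ (-a - 1) * L s with hK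
  have hKpos : 0 < K := hL.integral_pos
  -- The factors come from the prior at `t ≤ 2 W³ / c²`, from `√(1 + 2 W) ≤ 3 W`, and from `W / (1 +
  -- t τ²) ≤ 1`. The threshold `max 1 t₀` puts the window where `L ≥ c₀`.
  refine ⟨(2 / c ^ 2) ^ (-a - 1) * c₀ / K * ((3⁻¹ : ℝ) ^ m * Real.exp (-(1 / 2))), max 1 t₀,
    by positivity, le_max_left _ _, fun W τ hW hτc hτ1 => ?_⟩
  have hW1 : 1 ≤ W := (le_max_left _ _).trans hW
  have hWt : t₀ ≤ W := (le_max_right _ _).trans hW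
  have hW0 : 0 < W := by linarith
  have hτ : 0 < τ := lt_of_lt_of_le (by positivity) hτc
  have hτ2 : τ ^ 2 ≤ 1 := pow_le_one₀ hτ.le hτ1
  set B := (2 / c ^ 2) ^ (-a - 1) * c₀ / K * ((3⁻¹ : ℝ) ^ m * Real.exp (-(1 / 2))) with hB
  have hlen : 1 ≤ W / τ ^ 2 := by
    rw [le_div_iff₀ (by positivity)]
    linarith
  have hWτ : W ≤ W / τ ^ 2 := by
    rw [le_div_iff₀ (by positivity)]
    nlinarith
  have hpt : ∀ t ∈ Set.Icc (W / τ ^ 2) (2 * (W / τ ^ 2)),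
      B * W ^ (-(3 * (a + 1) + m)) ≤ localPosterior a L m τ W t := by
    rintro t ⟨ht1, ht2⟩
    have ht : 0 < t := by linarith
    have hu1 : W ≤ t * τ ^ 2 := by rwa [div_le_iff₀ (by positivity)] at ht1
    have hu2 : t * τ ^ 2 ≤ 2 * W := by
      rw [← mul_div_assoc, le_div_iff₀ (by positivity)] at ht2
      exact ht2
    have hprior : (2 / c ^ 2) ^ (-a - 1) * W ^ (-(3 * (a + 1))) * c₀ / K ≤ localPrior a L t := by
      rw [localPrior, Set.indicator_of_mem (show t ∈ Set.Ioi (0 : ℝ) from ht)]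
      refine div_le_div_of_nonneg_right ?_ hKpos.le
      refine mul_le_mul ?_ (hlow t (by linarith)) hc₀.le (by positivity)
      have h1 : t ≤ 2 / c ^ 2 * W ^ (3 : ℝ) := by
        refine ht2.trans ?_
        have h2 : (c / W) ^ 2 ≤ τ ^ 2 := pow_le_pow_left₀ (by positivity) hτc 2
        have h3 : W / τ ^ 2 ≤ W / (c / W) ^ 2 :=
          div_le_div_of_nonneg_left hW0.le (by positivity) h2
        have h4 : 2 * (W / (c / W) ^ 2) = 2 / c ^ 2 * W ^ (3 : ℝ) := by
          rw [show (3 : ℝ) = ((3 : ℕ) : ℝ) by norm_num, Real.rpow_natCast]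
          field_simp
        linarith
      have h5 := Real.rpow_le_rpow_of_nonpos ht h1 (show -a - 1 ≤ 0 by linarith)
      rw [Real.mul_rpow (by positivity) (by positivity), ← Real.rpow_mul hW0.le] at h5
      have : (3 : ℝ) * (-a - 1) = -(3 * (a + 1)) := by ring
      rwa [this] at h5
    have hsqrt : (3⁻¹ : ℝ) ^ m * W ^ (-(m : ℝ)) ≤ (Real.sqrt (1 + t * τ ^ 2))⁻¹ ^ m := by
      rw [Real.rpow_neg hW0.le, Real.rpow_natCast, ← inv_pow, ← mul_pow]
      refine pow_le_pow_left₀ (by positivity) ?_ m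
      rw [← mul_inv]
      refine inv_anti₀ (by positivity) ?_
      rw [Real.sqrt_le_left (by positivity)]
      nlinarith
    have hexp : Real.exp (-(1 / 2)) ≤ Real.exp (-(W / 2) / (1 + t * τ ^ 2)) := by
      rw [Real.exp_le_exp, neg_div, neg_le_neg_iff, div_le_iff₀ (by positivity)]
      linarith
    have hsplit : W ^ (-(3 * (a + 1) + m)) = W ^ (-(3 * (a + 1))) * W ^ (-(m : ℝ)) := by
      rw [← Real.rpow_add hW0]
      congr 1
      ring
    calc B * W ^ (-(3 * (a + 1) + m))
        = ((2 / c ^ 2) ^ (-a - 1) * W ^ (-(3 * (a + 1))) * c₀ / K) *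
          (((3⁻¹ : ℝ) ^ m * W ^ (-(m : ℝ))) * Real.exp (-(1 / 2))) := by
          rw [hsplit, hB]; ring
      _ ≤ localPosterior a L m τ W t := by
          rw [localPosterior]
          exact mul_le_mul hprior (mul_le_mul hsqrt hexp (Real.exp_pos _).le (by positivity))
            (by positivity) (hL.localPrior_nonneg t)
  have hint := hL.integrable_localPosterior (m := m) (τ := τ) hW0.le
  have hBW : 0 ≤ B * W ^ (-(3 * (a + 1) + m)) := by positivity
  calc B * W ^ (-(3 * (a + 1) + m))
      ≤ B * W ^ (-(3 * (a + 1) + m)) *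
        volume.real (Set.Icc (W / τ ^ 2) (2 * (W / τ ^ 2))) := by
        refine le_mul_of_one_le_right hBW ?_
        rw [Real.volume_real_Icc_of_le (by linarith)]
        linarith
    _ ≤ ∫ t in Set.Icc (W / τ ^ 2) (2 * (W / τ ^ 2)), localPosterior a L m τ W t :=
        setIntegral_ge_of_const_le_real measurableSet_Icc (by simp) hpt hint.integrableOn
    _ ≤ ∫ t, localPosterior a L m τ W t :=
        setIntegral_le_integral hint (Eventually.of_forall hL.localPosterior_nonneg)

/-- If the global parameter is not smaller than a multiple of `1 / W`, then the posterior mean of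
the shrinkage factor is of smaller order than `1 / √W`. -/
theorem IsPriorFactor.exists_sqrt_mul_meanKappa_le (hL : IsPriorFactor a L)
    (hLb : IsBoundedFactor L) (ha : 0 < a) (m : ℕ) {c : ℝ} (hc : 0 < c) {ε : ℝ} (hε : 0 < ε) :
    ∃ W₀ : ℝ, 1 ≤ W₀ ∧ ∀ W τ, W₀ ≤ W → c / W ≤ τ → τ ≤ 1 →
      Real.sqrt W * meanKappa a L m τ W ≤ ε := by
  obtain ⟨B, W₀, hB, hW₀, hlow⟩ := hL.exists_le_integral_localPosterior hLb ha m hc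
  set q : ℝ := 3 * (a + 1) + m with hq
  -- These are the two terms of `meanKappa_le` times `√W` for `η = W ^ (-3/4)`: then `√W η = W ^
  -- (-1/4)` vanishes, while `W η = W ^ (1/4)` lets the exponential beat `W ^ (1/2 + q)`, here
  -- written as a power of `W ^ (1/4)`.
  have hlim : Tendsto (fun W : ℝ => W ^ (-(1 / 4) : ℝ) +
      B⁻¹ * ((W ^ (1 / 4 : ℝ)) ^ (4 * (1 / 2 + q)) * Real.exp (-(1 / 2) * W ^ (1 / 4 : ℝ))))
      atTop (𝓝 (0 + B⁻¹ * 0)) := by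
    refine (tendsto_rpow_neg_atTop (by norm_num)).add (Tendsto.const_mul _ ?_)
    exact (tendsto_rpow_mul_exp_neg_mul_atTop_nhds_zero (4 * (1 / 2 + q)) (1 / 2)
      (by norm_num)).comp (tendsto_rpow_atTop (by norm_num))
  rw [mul_zero, add_zero] at hlim
  obtain ⟨W₁, hW₁⟩ := eventually_atTop.1 (hlim.eventually_le_const hε)
  refine ⟨max W₀ W₁, hW₀.trans (le_max_left _ _), fun W τ hW hτc hτ1 => ?_⟩
  have hWW := (le_max_left _ _).trans hW
  have hW0 : 0 < W := by linarith
  refine le_trans ?_ (hW₁ W ((le_max_right _ _).trans hW))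
  have h1 := hL.meanKappa_le (m := m) (τ := τ) hW0.le
    (show 0 ≤ W ^ (-(3 / 4) : ℝ) by positivity)
  have h2 := hlow W τ hWW hτc hτ1
  have h3 : Real.exp (-(W * W ^ (-(3 / 4) : ℝ) / 2)) / ∫ t, localPosterior a L m τ W t ≤
      Real.exp (-(W * W ^ (-(3 / 4) : ℝ) / 2)) / (B * W ^ (-q)) :=
    div_le_div_of_nonneg_left (Real.exp_pos _).le (by positivity) h2
  have h4 : W * W ^ (-(3 / 4) : ℝ) = W ^ (1 / 4 : ℝ) := by
    nth_rewrite 1 [← Real.rpow_one W]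
    rw [← Real.rpow_add hW0]
    norm_num
  have h5 : (W ^ (1 / 4 : ℝ)) ^ (4 * (1 / 2 + q)) = W ^ (1 / 2 : ℝ) * W ^ q := by
    rw [← Real.rpow_mul hW0.le, ← Real.rpow_add hW0]
    congr 1
    ring
  have h6 : W ^ (1 / 2 : ℝ) * W ^ (-(3 / 4) : ℝ) = W ^ (-(1 / 4) : ℝ) := by
    rw [← Real.rpow_add hW0]
    norm_num
  rw [h4] at h1 h3
  rw [h5, Real.sqrt_eq_rpow, ← h6]
  calc W ^ (1 / 2 : ℝ) * meanKappa a L m τ W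
      ≤ W ^ (1 / 2 : ℝ) * (W ^ (-(3 / 4) : ℝ) +
          Real.exp (-(W ^ (1 / 4 : ℝ) / 2)) / (B * W ^ (-q))) :=
        mul_le_mul_of_nonneg_left (h1.trans (by linarith)) (by positivity)
    _ = _ := by
        rw [Real.rpow_neg hW0.le q, mul_add]
        congr 1
        have : W ^ q ≠ 0 := by positivity
        have h7 : -(1 / 2) * W ^ (1 / 4 : ℝ) = -(W ^ (1 / 4 : ℝ) / 2) := by ring
        rw [h7]
        field_simp

end Concentration

/-! ### Measurability of the estimators -/

theorem measurable_mvnDensity {α ι : Type*} [MeasurableSpace α] [Fintype ι] [DecidableEq ι]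
    {c : α → ℝ} (hc : Measurable c) (M : Matrix ι ι ℝ) {μ x : α → ι → ℝ} (hμ : Measurable μ)
    (hx : Measurable x) : Measurable (fun ω => mvnDensity (μ ω) (c ω • M) (x ω)) := by
  have hcM : Continuous fun r : ℝ => r • M := by fun_prop
  have hdet : Measurable fun ω => (c ω • M).det := hcM.matrix_det.measurable.comp hc
  have hinv : ∀ i j, Measurable fun ω => (c ω • M)⁻¹ i j := by
    intro i j
    -- This formula also holds for singular matrices, where both sides are zero, so no case
    -- distinction on `c ω` is needed.
    have h : ∀ ω, (c ω • M)⁻¹ i j = ((c ω • M).det)⁻¹ * (c ω • M).adjugate i j := by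
      intro ω
      rw [Matrix.inv_def, Ring.inverse_eq_inv']
      rfl
    simp_rw [h]
    exact hdet.inv.mul ((hcM.matrix_adjugate.matrix_elem i j).measurable.comp hc)
  unfold mvnDensity
  simp only [dotProduct, Matrix.mulVec, Pi.sub_apply]
  have hd : ∀ i, Measurable fun ω => x ω i - μ ω i := fun i =>
    ((measurable_pi_apply i).comp hx).sub ((measurable_pi_apply i).comp hμ)
  refine (Measurable.inv ?_).mul (Measurable.exp (Measurable.const_mul ?_ _))
  · exact (hdet.const_mul _).sqrt
  · refine Finset.measurable_sum _ fun i _ => (hd i).mul ?_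
    exact Finset.measurable_sum _ fun j _ => (hinv i j).mul (hd j)

namespace Design

variable {n : ℕ} (D : Design n) {a : ℝ} {L : ℝ → ℝ} {σ : ℝ}

theorem continuous_fit : Continuous D.fit := by
  unfold fit
  fun_prop

theorem continuous_leastSquares (g : Fin D.G) (j : Fin (D.m g)) :
    Continuous fun y => D.leastSquares y g j := by
  unfold leastSquares
  fun_prop

theorem measurable_W (g : Fin D.G) : Measurable fun y => D.W σ y g := by
  have h : Continuous fun y => D.leastSquares y g :=
    continuous_pi fun j => D.continuous_leastSquares g j
  unfold W
  refine Continuous.measurable ?_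
  fun_prop

theorem measurable_tauEB (c₁ c₂ : ℝ) : Measurable (D.tauEB c₁ c₂ σ) := by
  unfold tauEB
  refine measurable_const.max (Measurable.const_mul ?_ _)
  simp_rw [Finset.card_filter]
  push_cast
  refine Finset.measurable_sum _ fun g _ => Measurable.ite ?_ measurable_const measurable_const
  exact measurableSet_lt measurable_const (D.measurable_W g)

theorem measurable_jointDensity (hL : IsPriorFactor a L) {α : Type*} [MeasurableSpace α]
    {τ : α → ℝ} (hτ : Measurable τ) {y : α → Fin n → ℝ} (hy : Measurable y)
    {θ : α → D.Param} (hθ : Measurable θ) :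
    Measurable fun ω => D.jointDensity a L σ (τ ω) (y ω) (θ ω) := by
  have hg : ∀ g, Measurable fun ω => θ ω g := fun g => (measurable_pi_apply g).comp hθ
  unfold jointDensity
  refine Measurable.mul ?_ (Finset.measurable_prod _ fun g _ => ?_)
  · refine measurable_mvnDensity measurable_const 1 ?_ hy
    exact D.continuous_fit.measurable.comp (measurable_pi_lambda _ fun g => (hg g).snd)
  · refine (hL.measurable_localPrior.comp (hg g).fst).mul ?_
    exact measurable_mvnDensity (((hg g).fst.mul_const _).mul (hτ.pow_const _)) _
      measurable_const (hg g).snd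

/-- Here `τ` is a function of `y`, as it is for the plugged-in estimate; joint measurability in `(y,
θ)` passes to the parametric integrals. -/
theorem measurable_posteriorExp (hL : IsPriorFactor a L) {τ : (Fin n → ℝ) → ℝ}
    (hτ : Measurable τ) {f : (Fin n → ℝ) → D.Param → ℝ} (hf : Measurable f.uncurry) :
    Measurable fun y => D.posteriorExp a L σ (τ y) y (f y) := by
  have hj : Measurable fun q : (Fin n → ℝ) × D.Param => D.jointDensity a L σ (τ q.1) q.1 q.2 :=
    D.measurable_jointDensity hL (hτ.comp measurable_fst) measurable_fst measurable_snd
  unfold posteriorExp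
  refine Measurable.div ?_ ?_
  · exact (StronglyMeasurable.integral_prod_right
      (f := fun y θ => f y θ * D.jointDensity a L σ (τ y) y θ)
      (hf.mul hj).stronglyMeasurable).measurable
  · exact (StronglyMeasurable.integral_prod_right
      (f := fun y θ => D.jointDensity a L σ (τ y) y θ) hj.stronglyMeasurable).measurable

theorem measurable_halfThresholdEB (hL : IsPriorFactor a L) (c₁ c₂ : ℝ) (g : Fin D.G)
    (j : Fin (D.m g)) : Measurable fun y => D.halfThresholdEB a L σ c₁ c₂ y g j := by
  have hτ := D.measurable_tauEB (σ := σ) c₁ c₂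
  have hw : Measurable fun y => D.shrinkWeight a L σ (D.tauEB c₁ c₂ σ y) y g := by
    unfold shrinkWeight
    refine D.measurable_posteriorExp hL hτ
      (f := fun y θ => 1 - 1 / (1 + (θ g).1 * D.tauEB c₁ c₂ σ y ^ 2)) ?_
    have h1 : Measurable fun q : (Fin n → ℝ) × D.Param => D.tauEB c₁ c₂ σ q.1 :=
      hτ.comp measurable_fst
    have h2 : Measurable fun q : (Fin n → ℝ) × D.Param => (q.2 g).1 :=
      ((measurable_pi_apply g).comp measurable_snd).fst
    exact measurable_const.sub (measurable_const.div
      (measurable_const.add (h2.mul (h1.pow_const 2))))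
  have hm : Measurable fun y => D.posteriorMean a L σ (D.tauEB c₁ c₂ σ y) y g j := by
    unfold posteriorMean
    refine D.measurable_posteriorExp hL hτ (f := fun _ θ => (θ g).2 j) ?_
    exact (measurable_pi_apply j).comp ((measurable_pi_apply g).comp measurable_snd).snd
  have h : ∀ y, D.halfThresholdEB a L σ c₁ c₂ y g j =
      if 1 / 2 < D.shrinkWeight a L σ (D.tauEB c₁ c₂ σ y) y g then
        D.posteriorMean a L σ (D.tauEB c₁ c₂ σ y) y g j else 0 := by
    intro y
    simp only [halfThresholdEB, halfThreshold]
    split_ifs <;> rfl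
  simp_rw [h]
  exact Measurable.ite (measurableSet_lt measurable_const hw) hm measurable_const

end Design

/-! ### Comparison of half-thresholding with least squares. -/

namespace Design

variable {n : ℕ} {D : Design n} {a : ℝ} {L : ℝ → ℝ} {σ : ℝ}

theorem one_div_le_tauEB (c₁ c₂ : ℝ) (y : Fin n → ℝ) : 1 / (D.G : ℝ) ≤ D.tauEB c₁ c₂ σ y :=
  le_max_left _ _

theorem tauEB_le_one (hG : 0 < D.G) (c₁ : ℝ) {c₂ : ℝ} (hc₂ : 1 ≤ c₂) (y : Fin n → ℝ) :
    D.tauEB c₁ c₂ σ y ≤ 1 := by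
  have hG' : (1 : ℝ) ≤ D.G := by exact_mod_cast hG
  refine max_le ((div_le_one (by linarith)).2 hG') ?_
  rw [one_div_mul_eq_div, div_le_one (by positivity)]
  calc _ ≤ ((D.G : ℕ) : ℝ) := by
        refine Nat.cast_le.2 ((Finset.card_filter_le _ _).trans ?_)
        simp
    _ ≤ c₂ * D.G := le_mul_of_one_le_left (by linarith) hc₂

theorem IsOrthogonal.leastSquares_sub (hD : D.IsOrthogonal) (hn : n ≠ 0) (y : Fin n → ℝ)
    (β : D.Coef) (g : Fin D.G) (j : Fin (D.m g)) :
    D.leastSquares y g j - β g j = (n : ℝ)⁻¹ * D.X.transpose.mulVec (y - D.fit β) ⟨g, j⟩ := by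
  have hn' : (n : ℝ) ≠ 0 := by exact_mod_cast hn
  rw [hD.leastSquares_eq hn, Matrix.mulVec_sub, fit, Matrix.mulVec_mulVec, hD, Matrix.smul_mulVec,
    Matrix.one_mulVec]
  simp only [Pi.sub_apply, Pi.smul_apply, smul_eq_mul]
  field_simp

/-- Under an orthogonal design the rescaled estimation error of the least squares estimate has an
exact normal law. -/
theorem IsOrthogonal.map_leastSquares (hD : D.IsOrthogonal) (hn : n ≠ 0) (β : D.Coef)
    (g : Fin D.G) {d : ℕ} (hd : D.m g = d) :
    (sphericalNormal (D.fit β) σ).map (fun y (j : Fin d) => Real.sqrt n *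
      (D.leastSquares y g (Fin.cast hd.symm j) - β g (Fin.cast hd.symm j))) =
      sphericalNormal (0 : Fin d → ℝ) σ := by
  subst hd
  have hn' : (0 : ℝ) < n := by positivity
  have hsq : Real.sqrt n * (n : ℝ)⁻¹ = (Real.sqrt n)⁻¹ := by
    rw [← div_eq_mul_inv, Real.sqrt_div_self', one_div]
  have hA : ((Real.sqrt n)⁻¹ • (D.block g).transpose) *
      ((Real.sqrt n)⁻¹ • (D.block g).transpose).transpose = 1 := by
    rw [Matrix.transpose_smul, Matrix.transpose_transpose, Matrix.smul_mul,
      Matrix.mul_smul, hD.block_transpose_mul_block, smul_smul, smul_smul, ← mul_inv, Real.mul_self_sqrt hn'.le,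
      inv_mul_cancel₀ hn'.ne', one_smul]
  rw [← map_mulVec_sphericalNormal _ hA (D.fit β) σ]
  congr 1
  ext y j
  simp only [Fin.cast_refl, id]
  rw [hD.leastSquares_sub hn, ← mul_assoc, hsq, Matrix.smul_mulVec]
  rfl

/-- As `W ≥ 1`, the hypothesis forces `κ ≤ δ < 1/2`, so the group survives thresholding and is
merely multiplied by `1 - κ`. The difference is `κ √n |β̂_gj|`, and `√n |β̂_gj| ≤ σ √W`. -/
theorem IsOrthogonal.halfThresholdEB_sub_leastSquares_le (hD : D.IsOrthogonal)
    (hL : IsPriorFactor a L) (hn : n ≠ 0) (hσ : 0 < σ) (c₁ c₂ : ℝ)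
    (y : Fin n → ℝ) (g : Fin D.G) {δ : ℝ} (hW : 1 ≤ D.W σ y g) (hδ : δ < 1 / 2)
    (hκ : Real.sqrt (D.W σ y g) *
      meanKappa a L (D.m g) (D.tauEB c₁ c₂ σ y) (D.W σ y g) ≤ δ) (j : Fin (D.m g)) :
    |Real.sqrt n * (D.halfThresholdEB a L σ c₁ c₂ y g j - D.leastSquares y g j)| ≤ σ * δ := by
  set τ := D.tauEB c₁ c₂ σ y with hτdef
  have hG : 0 < D.G := g.pos
  have hG' : (0 : ℝ) < D.G := by exact_mod_cast hG
  have hτ : 0 < τ := lt_of_lt_of_le (by positivity) (one_div_le_tauEB c₁ c₂ y)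
  set κ := meanKappa a L (D.m g) τ (D.W σ y g) with hκdef
  have hκ0 : 0 ≤ κ := hL.meanKappa_nonneg _ _
  have hw : D.shrinkWeight a L σ τ y g = 1 - κ := by
    rw [hD.shrinkWeight_eq hL hn hσ hτ, hL.one_sub_meanKappa (by linarith)]
  have hs1 : 1 ≤ Real.sqrt (D.W σ y g) := by rwa [Real.one_le_sqrt]
  have hκδ : κ ≤ δ := (le_mul_of_one_le_left hκ0 hs1).trans hκ
  have hHT : D.halfThresholdEB a L σ c₁ c₂ y g j = (1 - κ) * D.leastSquares y g j := by
    simp only [halfThresholdEB, halfThreshold]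
    rw [← hτdef, if_pos (by rw [hw]; linarith), hD.posteriorMean_eq hL hn hσ hτ, hw]
  have hb : Real.sqrt n * |D.leastSquares y g j| ≤ σ * Real.sqrt (D.W σ y g) := by
    rw [hD.W_eq hn]
    refine abs_le_of_sq_le_sq' ?_ (by positivity) |>.2
    rw [mul_pow, mul_pow, Real.sq_sqrt (by positivity), Real.sq_sqrt (by positivity), sq_abs,
      ← mul_assoc, mul_div_cancel₀ _ (by positivity)]
    refine mul_le_mul_of_nonneg_left ?_ (by positivity)
    exact Finset.single_le_sum (f := fun j => D.leastSquares y g j ^ 2)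
      (fun i _ => sq_nonneg _) (Finset.mem_univ j)
  have heq : Real.sqrt n * (D.halfThresholdEB a L σ c₁ c₂ y g j - D.leastSquares y g j) =
      -(κ * (Real.sqrt n * D.leastSquares y g j)) := by
    rw [hHT]; ring
  rw [heq, abs_neg, abs_mul, abs_mul, abs_of_nonneg hκ0, abs_of_nonneg (Real.sqrt_nonneg _)]
  calc κ * (Real.sqrt n * |D.leastSquares y g j|) ≤ κ * (σ * Real.sqrt (D.W σ y g)) :=
        mul_le_mul_of_nonneg_left hb hκ0
    _ = σ * (Real.sqrt (D.W σ y g) * κ) := by ring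
    _ ≤ σ * δ := mul_le_mul_of_nonneg_left hκ hσ.le

end Design

/-- If a coefficient of a group is bounded away from zero and its least squares estimate is close
to it, then half-thresholding hardly changes the least squares estimate of the group. -/
theorem exists_halfThresholdEB_sub_leastSquares_le {σ : ℝ} (hσ : 0 < σ) {a : ℝ} (ha : 0 < a)
    {L : ℝ → ℝ} (hL : IsPriorFactor a L) (hLb : IsBoundedFactor L) (c₁ : ℝ) {c₂ : ℝ}
    (hc₂ : 1 ≤ c₂) {C : ℝ} (hC : 0 < C) (d : ℕ) {ε : ℝ} (hε : 0 < ε) :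
    ∃ N : ℕ, ∀ n, N ≤ n → ∀ D : Design n, D.IsOrthogonal → D.G ≤ n → ∀ (g : Fin D.G),
      D.m g = d → ∀ (β : D.Coef) (i : Fin (D.m g)), C < |β g i| → ∀ y : Fin n → ℝ,
      |D.leastSquares y g i - β g i| ≤ C / 2 → ∀ j,
      |Real.sqrt n * (D.halfThresholdEB a L σ c₁ c₂ y g j - D.leastSquares y g j)| ≤ ε := by
  -- The cap `1/4` keeps the mean of `κ` strictly below the threshold `1/2`.
  have hδ : 0 < min (ε / σ) (1 / 4) := by positivity
  -- A single coordinate with `|β̂_gi| ≥ C / 2` already gives `W ≥ c n`, whence `c / W ≤ 1 / n ≤ 1 /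
  -- G ≤ τ`.
  set c := (C / 2) ^ 2 / σ ^ 2 with hc
  have hc0 : 0 < c := by positivity
  obtain ⟨W₀, hW₀, hκ⟩ := hL.exists_sqrt_mul_meanKappa_le hLb ha d hc0 hδ
  obtain ⟨N, hN⟩ := exists_nat_ge (W₀ / c)
  refine ⟨max N 1, fun n hn D hD hG g hm β i hi y hy j => ?_⟩
  subst hm
  have hn1 : 1 ≤ n := (le_max_right _ _).trans hn
  have hn0 : n ≠ 0 := by omega
  have hn' : (0 : ℝ) < n := by positivity
  have hb : C / 2 ≤ |D.leastSquares y g i| := by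
    have := abs_sub_abs_le_abs_sub (β g i) (D.leastSquares y g i)
    rw [abs_sub_comm] at this
    linarith
  have hWc : c * n ≤ D.W σ y g := by
    rw [hD.W_eq hn0, hc, div_mul_eq_mul_div, mul_comm, mul_div_right_comm]
    refine mul_le_mul_of_nonneg_left ?_ (by positivity)
    calc (C / 2) ^ 2 ≤ |D.leastSquares y g i| ^ 2 := pow_le_pow_left₀ (by positivity) hb 2
      _ = D.leastSquares y g i ^ 2 := sq_abs _
      _ ≤ _ := Finset.single_le_sum (f := fun j => D.leastSquares y g j ^ 2)
        (fun i _ => sq_nonneg _) (Finset.mem_univ i)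
  have hWW : W₀ ≤ D.W σ y g := by
    refine le_trans ?_ hWc
    have : (N : ℝ) ≤ n := by exact_mod_cast (le_max_left _ _).trans hn
    rw [← div_le_iff₀' hc0]
    exact hN.trans this
  have hG0 : (0 : ℝ) < D.G := by exact_mod_cast g.pos
  have hτ : c / D.W σ y g ≤ D.tauEB c₁ c₂ σ y := by
    refine le_trans ?_ (D.one_div_le_tauEB c₁ c₂ y)
    have hGn : (D.G : ℝ) ≤ n := by exact_mod_cast hG
    rw [div_le_div_iff₀ (by linarith) hG0, one_mul]
    exact (mul_le_mul_of_nonneg_left hGn hc0.le).trans hWc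
  refine (hD.halfThresholdEB_sub_leastSquares_le hL hn0 hσ c₁ c₂ y g (by linarith)
    (lt_of_le_of_lt (min_le_right (ε / σ) _) (by norm_num))
    (hκ _ _ hWW hτ (D.tauEB_le_one g.pos c₁ hc₂ y)) j).trans ?_
  calc σ * min (ε / σ) (1 / 4) ≤ σ * (ε / σ) :=
        mul_le_mul_of_nonneg_left (min_le_left _ _) hσ.le
    _ = ε := by field_simp

/-- Tightness of one fixed law. With `ν` the exact law of the rescaled least squares error, it
bounds the probability that this error exceeds `C₃ / 2` before rescaling. -/
theorem tendsto_measure_lt_abs_coord {d : ℕ} (ν : Measure (Fin d → ℝ)) [IsFiniteMeasure ν]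
    (i : Fin d) {c : ℝ} (hc : 0 < c) :
    Tendsto (fun n : ℕ => ν {z | c * Real.sqrt n < |z i|}) atTop (𝓝 0) := by
  have hempty : ⋂ n : ℕ, {z : Fin d → ℝ | c * Real.sqrt n < |z i|} = ∅ := by
    refine Set.eq_empty_of_forall_notMem fun z hz => ?_
    have h1 : Tendsto (fun n : ℕ => c * Real.sqrt n) atTop atTop :=
      (Real.tendsto_sqrt_atTop.comp tendsto_natCast_atTop_atTop).const_mul_atTop hc
    obtain ⟨n, hn⟩ := (h1.eventually_ge_atTop |z i|).exists
    exact absurd (Set.mem_iInter.1 hz n) (not_lt.2 hn)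
  have h := tendsto_measure_iInter_atTop (μ := ν)
    (s := fun n : ℕ => {z : Fin d → ℝ | c * Real.sqrt n < |z i|})
    (fun n => (measurableSet_lt measurable_const (by fun_prop)).nullMeasurableSet)
    (fun p q hpq z hz => lt_of_le_of_lt (mul_le_mul_of_nonneg_left
      (Real.sqrt_le_sqrt (Nat.cast_le.2 hpq)) hc.le) hz) ⟨0, measure_ne_top _ _⟩
  rwa [hempty, measure_empty] at h

end GroupHT

end

/-! ### Passage to the limit. -/

theorem corollary1
    -- the known error standard deviation, the prior, and the constants of the estimate of `τ`
    (σ : ℝ) (hσ : 0 < σ)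
    (a : ℝ) (ha : 0 < a) (L : ℝ → ℝ)
    (hL : GroupHT.IsPriorFactor a L) (hLb : GroupHT.IsBoundedFactor L)
    (c₁ c₂ : ℝ) (hc₁ : 2 ≤ c₁) (hc₂ : 1 ≤ c₂)
    -- for every sample size `n`: the design, the true coefficients and the data
    (D : (n : ℕ) → GroupHT.Design n)
    (β₀ : (n : ℕ) → (D n).Coef)
    {Ω : ℕ → Type*} [∀ n, MeasurableSpace (Ω n)]
    (P : (n : ℕ) → Measure (Ω n)) [∀ n, IsProbabilityMeasure (P n)]
    (y : (n : ℕ) → Ω n → Fin n → ℝ)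
    (hy : ∀ n, HasLaw (y n) (GroupHT.sphericalNormal ((D n).fit (β₀ n)) σ) (P n))
    -- at most `n` groups, orthogonal design
    (hG : ∀ᶠ n in atTop, (D n).G ≤ n)
    (hX : ∀ᶠ n in atTop, (D n).IsOrthogonal)
    -- the number of active groups does not depend on `n`
    (k : ℕ) (hk : ∀ᶠ n in atTop, ((D n).active (β₀ n)).card = k)
    -- bounded group sizes
    (s : ℕ) (hs : ∀ᶠ n in atTop, ∀ g, (D n).m g ≤ s)
    -- the coefficients of the active groups are bounded away from zero
    (C₃ : ℝ) (hC₃ : 0 < C₃)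
    (hβ : ∀ᶠ n in atTop, ∀ g ∈ (D n).active (β₀ n), ∀ j, C₃ < |β₀ n g j|)
    -- an active group of size `d` for every (large) `n`
    (g : (n : ℕ) → Fin (D n).G) (d : ℕ) (hd : ∀ n, (D n).m (g n) = d)
    (hg : ∀ᶠ n in atTop, g n ∈ (D n).active (β₀ n)) :
    TendstoInDistribution
      (fun (n : ℕ) (ω : Ω n) (j : Fin d) =>
        Real.sqrt n *
          ((D n).halfThresholdEB a L σ c₁ c₂ (y n ω) (g n) (Fin.cast (hd n).symm j)
            - β₀ n (g n) (Fin.cast (hd n).symm j)))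
      atTop
      (id : (Fin d → ℝ) → (Fin d → ℝ))
      P
      (GroupHT.sphericalNormal (0 : Fin d → ℝ) σ) := by
  set μ : (n : ℕ) → Measure (Fin n → ℝ) :=
    fun n => GroupHT.sphericalNormal ((D n).fit (β₀ n)) σ with hμ
  set T : (n : ℕ) → (Fin n → ℝ) → Fin d → ℝ := fun n y j => Real.sqrt n *
    ((D n).halfThresholdEB a L σ c₁ c₂ y (g n) (Fin.cast (hd n).symm j)
      - β₀ n (g n) (Fin.cast (hd n).symm j)) with hT
  set Z : (n : ℕ) → (Fin n → ℝ) → Fin d → ℝ := fun n y j => Real.sqrt n *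
    ((D n).leastSquares y (g n) (Fin.cast (hd n).symm j)
      - β₀ n (g n) (Fin.cast (hd n).symm j)) with hZ
  have hTm : ∀ n, Measurable (T n) := fun n => measurable_pi_lambda _ fun j =>
    (((D n).measurable_halfThresholdEB hL c₁ c₂ (g n) _).sub_const _).const_mul _
  have hZm : ∀ n, Measurable (Z n) := fun n => measurable_pi_lambda _ fun j =>
    (((D n).continuous_leastSquares (g n) _).measurable.sub_const _).const_mul _
  have hZlaw : ∀ᶠ n in atTop, (μ n).map (Z n) = GroupHT.sphericalNormal (0 : Fin d → ℝ) σ := by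
    filter_upwards [hX, eventually_ge_atTop 1] with n hn hn1
    exact hn.map_leastSquares (by omega) (β₀ n) (g n) (hd n)
  -- An active group has a nonzero coefficient vector, hence a coordinate; the zeroth one is used
  -- below to make `W` large.
  have hd0 : 0 < d := by
    obtain ⟨n, hn⟩ := hg.exists
    rw [Nat.pos_iff_ne_zero]
    rintro rfl
    have hne : β₀ n (g n) ≠ 0 := by simpa [GroupHT.Design.active] using hn
    refine hne (funext fun j => ?_)
    exact Fin.elim0 (Fin.cast (hd n) j)
  -- The data for different `n` may live on different probability spaces. Convergence in
  -- distribution sees only the individual laws, so these are realised as coordinates of one product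
  -- space, on which Slutsky's theorem applies.
  set ν : Measure ((n : ℕ) → Fin n → ℝ) := Measure.infinitePi μ with hν
  have heval : ∀ n, ν.map (Function.eval n) = μ n := fun n =>
    (measurePreserving_eval_infinitePi μ n).map_eq
  have hTe : ∀ n, Measurable fun ω : (n : ℕ) → Fin n → ℝ => T n (ω n) := fun n =>
    (hTm n).comp (measurable_pi_apply n)
  have hZe : ∀ n, Measurable fun ω : (n : ℕ) → Fin n → ℝ => Z n (ω n) := fun n =>
    (hZm n).comp (measurable_pi_apply n)
  have hTmap : ∀ n, ν.map (fun ω => T n (ω n)) = (μ n).map (T n) := fun n => by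
    rw [← heval n, Measure.map_map (hTm n) (measurable_pi_apply n)]
    rfl
  have hZmap : ∀ n, ν.map (fun ω => Z n (ω n)) = (μ n).map (Z n) := fun n => by
    rw [← heval n, Measure.map_map (hZm n) (measurable_pi_apply n)]
    rfl
  have hZconv : TendstoInDistribution (fun (n : ℕ) (ω : (n : ℕ) → Fin n → ℝ) => Z n (ω n)) atTop
      (id : (Fin d → ℝ) → (Fin d → ℝ)) (fun _ => ν)
      (GroupHT.sphericalNormal (0 : Fin d → ℝ) σ) := by
    refine ⟨fun n => (hZe n).aemeasurable, aemeasurable_id, ?_⟩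
    refine tendsto_const_nhds.congr' ?_
    filter_upwards [hZlaw] with n hn
    refine Subtype.ext ?_
    change Measure.map id _ = Measure.map _ _
    rw [Measure.map_id, hZmap, hn]
  have hsmall : TendstoInMeasure ν ((fun (n : ℕ) (ω : (n : ℕ) → Fin n → ℝ) => T n (ω n)) -
      (fun (n : ℕ) (ω : (n : ℕ) → Fin n → ℝ) => Z n (ω n))) atTop 0 := by
    rw [tendstoInMeasure_iff_norm]
    intro ε hε
    obtain ⟨N, hN⟩ := GroupHT.exists_halfThresholdEB_sub_leastSquares_le hσ ha hL hLb c₁ hc₂ hC₃ d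
      (half_pos hε)
    have hlim := GroupHT.tendsto_measure_lt_abs_coord
      (GroupHT.sphericalNormal (0 : Fin d → ℝ) σ) ⟨0, hd0⟩ (half_pos hC₃)
    refine tendsto_of_tendsto_of_tendsto_of_le_of_le' tendsto_const_nhds hlim
      (Eventually.of_forall fun _ => zero_le) ?_
    filter_upwards [hX, hG, hβ, hg, hZlaw, eventually_ge_atTop N, eventually_ge_atTop 1]
      with n hXn hGn hβn hgn hZn hNn hn1
    rw [← hZn, ← hZmap, Measure.map_apply (hZe n) (measurableSet_lt measurable_const (by fun_prop))]
    refine measure_mono fun ω hω => ?_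
    -- If coordinate zero of least squares is within `C₃ / 2` of the truth, the difference is at
    -- most `ε / 2`, which excludes the event `ε ≤ ‖T - Z‖`.
    by_contra hcon
    simp only [Set.mem_preimage, Set.mem_ofPred_eq, not_lt] at hcon
    have hn0 : (0 : ℝ) < Real.sqrt n := Real.sqrt_pos.2 (by exact_mod_cast hn1)
    have hls : |(D n).leastSquares (ω n) (g n) (Fin.cast (hd n).symm ⟨0, hd0⟩)
        - β₀ n (g n) (Fin.cast (hd n).symm ⟨0, hd0⟩)| ≤ C₃ / 2 := by
      simp only [hZ] at hcon
      rw [abs_mul, abs_of_pos hn0, mul_comm] at hcon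
      exact le_of_mul_le_mul_right hcon hn0
    have hbound := hN n hNn (D n) hXn hGn (g n) (hd n) (β₀ n) _ (hβn (g n) hgn _) (ω n) hls
    have hnorm : ‖T n (ω n) - Z n (ω n)‖ ≤ ε / 2 := by
      refine (pi_norm_le_iff_of_nonneg (half_pos hε).le).2 fun j => ?_
      have := hbound (Fin.cast (hd n).symm j)
      rw [Real.norm_eq_abs]
      convert this using 2
      simp only [hT, hZ, Pi.sub_apply]
      ring
    have hω' : ε ≤ ‖T n (ω n) - Z n (ω n)‖ := by simpa using hω
    linarith
  have hTconv := tendstoInDistribution_of_tendstoInMeasure_sub _ _ hZconv hsmall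
    fun n => (hTe n).aemeasurable
  have hTy : ∀ n, AEMeasurable (fun ω => T n (y n ω)) (P n) := fun n =>
    (hTm n).comp_aemeasurable (hy n).aemeasurable
  -- The limit is carried back to the given spaces: `T n` has the same law under `ν` as under `P n`.
  refine ⟨hTy, aemeasurable_id, hTconv.tendsto.congr fun n => Subtype.ext ?_⟩
  change Measure.map (fun ω => T n (ω n)) ν = Measure.map (fun ω => T n (y n ω)) (P n)
  rw [hTmap n, show μ n = (P n).map (y n) from (hy n).map_eq.symm,
    AEMeasurable.map_map_of_aemeasurable (hTm n).aemeasurable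
    (hy n).aemeasurable]
  rfl
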